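/- **Setting.** All manifolds are smooth, Hausdorff and finite dimensional. Let $\mathcal G \rightrightarrows M$ be a Lie groupoid with source $s$, target $t$, unit $1$, multiplication $m:\mathcal G^{(2)}\to\mathcal G$ ($gh$ is defined iff $s(g)=t(h)$), projections $\mathrm{pr}_1,\mathrm{pr}_2:\mathcal G^{(2)}\to\mathcal G$, and Lie algebroid $A$, $A_x=\ker (ds)_{1_x}$. Let $\mathcal G$ act smoothly and linearly on a real line bundle $L\to M$ (the action of $g$ is an isomorphism $L_{s(g)}\to L_{t(g)}$, $\ell\mapsto g.\ell$), and let $L_{\mathcal G}=t^*L$, with the LB-groupoid structure $(t^*L\rightrightarrows 0_M;\mathcal G\rightrightarrows M)$ with multiplication $(g,\ell)\cdot(h,\ell')=(gh,\ell+g.\ell')$. **Derivations, jets, Atiyah tensors.** For a line bundle $L\to M$, $D_xL$ is the space of $\mathbb R$-linear maps $\Delta:\Gamma(L)\to L_x$ such that, for some $v\in T_xM$, $\Delta(f\lambda)=v(f)\lambda_x+f(x)\Delta\lambda$ for all $f\in C^\infty(M)$, $\lambda\in\Gamma(L)$; and $\mathfrak J^1L=\mathrm{Hom}(DL,L)$.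 A line bundle map $\varphi:L_N\to L$ which is an isomorphism on fibers induces $D\varphi:DL_N\to DL$, $D\varphi(\Delta)\lambda=\varphi(\Delta(\varphi^*\lambda))$. An Atiyah $(l,m)$-tensor on $L$ is a smooth section $T$ of $(DL)^{*\otimes l}\otimes(\mathfrak J^1L)^{*\otimes m}\otimes L$. **Groupoids $DL_{\mathcal G}\rightrightarrows DL$ and $\mathfrak J^1L_{\mathcal G}\rightrightarrows A^*\otimes L$.** Identify the line bundle $m^*L_{\mathcal G}$ over $\mathcal G^{(2)}$, whose fiber over $(g,h)$ is $L_{t(g)}$, with $\mathrm{pr}_1^*L_{\mathcal G}$ by the identity and with $\mathrm{pr}_2^*L_{\mathcal G}$ by $\ell\mapsto g^{-1}.\ell$. The source and target of $DL_{\mathcal G}$ are induced by the line bundle maps $L_{\mathcal G}\to L$, $(g,\ell)\mapsto g^{-1}.\ell$ and $(g,\ell)\mapsto\ell$; the composable pairs are the pairs $(D\mathrm{pr}_1(\square),D\mathrm{pr}_2(\square))$ with $\square\in D(m^*L_{\mathcal G})$, with product $Dm(\square)$; the unit and the inversion $i_D$ are induced by $L\to L_{\mathcal G}$, $\ell\mapsto(1,\ell)$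 and by $L_{\mathcal G}\to L_{\mathcal G}$, $(g,\ell)\mapsto(g^{-1},g^{-1}.\ell)$. For $a\in A_x$ let $\mathbb D_a\in D_{1_x}L_{\mathcal G}$ be the element of the kernel of the source map of $DL_{\mathcal G}$ with symbol $a$. For $\psi\in\mathfrak J^1L_{\mathcal G}$ over $g$, source and target are given by $$\langle s(\psi),a\rangle=-g^{-1}.\langle\psi,0_g\cdot i_D(\mathbb D_a)\rangle,\qquad \langle t(\psi),b\rangle=\langle\psi,\mathbb D_b\cdot 0_g\rangle\qquad(a\in A_{s(g)},\ b\in A_{t(g)}),$$ and, for $\psi_1,\psi_2$ composable over $(g,h)$, the product $\psi_1\cdot\psi_2$ is determined by $\langle\psi_1\cdot\psi_2,\Delta_1\cdot\Delta_2\rangle=\langle\psi_1,\Delta_1\rangle+g.\langle\psi_2,\Delta_2\rangle$ for all composable $\Delta_1,\Delta_2\in DL_{\mathcal G}$ over $(g,h)$. **Multiplicativity.** An Atiyah $(l,m)$-tensor $T$ on $L_{\mathcal G}$ is *multiplicative* if the map $$f_T:\underbrace{DL_{\mathcal G}\times_{\mathcal G}\cdots\times_{\mathcal G}DL_{\mathcal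 G}}_{l}\times_{\mathcal G}\underbrace{\mathfrak J^1L_{\mathcal G}\times_{\mathcal G}\cdots\times_{\mathcal G}\mathfrak J^1L_{\mathcal G}}_{m}\to L_{\mathcal G}$$ obtained by evaluating $T$ is a groupoid map, the left-hand side having the component-wise groupoid structure. An ordinary $(l,m)$-tensor $\mathcal T$ on a Lie groupoid $\mathcal H$ (a section of $(T^*\mathcal H)^{\otimes l}\otimes(T\mathcal H)^{\otimes m}$) is *multiplicative* if the function $f_{\mathcal T}$ on the groupoid $T\mathcal H\times_{\mathcal H}\cdots\times_{\mathcal H}T\mathcal H\times_{\mathcal H}T^*\mathcal H\times_{\mathcal H}\cdots\times_{\mathcal H}T^*\mathcal H$ ($l$ factors $T\mathcal H$, $m$ factors $T^*\mathcal H$, with the tangent and cotangent groupoid structures) satisfies $f_{\mathcal T}(\Theta_1\cdot\Theta_2)=f_{\mathcal T}(\Theta_1)+f_{\mathcal T}(\Theta_2)$ for all composable $\Theta_1,\Theta_2$. **Homogenization.** The homogenization of $L\to M$ is $\widetilde M=L^*\smallsetminus 0$, with fiberwise bijective maps $p_T:T\widetilde M\to DL$ and $p_{T^*}:T^*\widetilde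 M\to\mathfrak J^1L$ given by $\langle\epsilon,p_T(v)\lambda\rangle=v(\tilde\lambda)$, where $\tilde\lambda(\epsilon)=\langle\epsilon,\lambda\rangle$, and $\langle\epsilon,\langle p_{T^*}(\theta),p_T(v)\rangle\rangle=\langle\theta,v\rangle$, for $v\in T_\epsilon\widetilde M$, $\theta\in T^*_\epsilon\widetilde M$, $\lambda\in\Gamma(L)$. The homogenization of an Atiyah $(l,m)$-tensor $T$ on $L$ is the $(l,m)$-tensor $\widetilde T$ on $\widetilde M$ with $$\widetilde T_\epsilon(v_1,\dots,v_l;\theta_1,\dots,\theta_m)=\langle\epsilon,T(p_Tv_1,\dots,p_Tv_l;p_{T^*}\theta_1,\dots,p_{T^*}\theta_m)\rangle .$$ The homogenization $\widetilde{\mathcal G}$ of $L_{\mathcal G}\to\mathcal G$ is a Lie groupoid over $\widetilde M$, namely the dual of the VB-groupoid $L_{\mathcal G}$ with the zero section removed: an arrow is a pair $(g,\epsilon)$ with $g\in\mathcal G$ and $0\ne\epsilon\in L^*_{t(g)}$, with source $g^{-1}.\epsilon$, target $\epsilon$, and $(g,\epsilon)\cdot(h,\delta)=(gh,\epsilon)$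 whenever $\delta=g^{-1}.\epsilon$. **Proposition.** Let $l,m\ge 0$. An Atiyah $(l,m)$-tensor $T$ on $L_{\mathcal G}$ is multiplicative if and only if its homogenization $\widetilde T$ is a multiplicative tensor on the groupoid $\widetilde{\mathcal G}$. -/

import Mathlib

open Bundle Set
open scoped Manifold ContDiff Topology

noncomputable section

section LineBundles

variable {E : Type*} [NormedAddCommGroup E] [NormedSpace ℝ E]
  {H : Type*} [TopologicalSpace H]

/-- A smooth real line bundle over the manifold `M`. -/
structure LineBundle (I : ModelWithCorners ℝ E H) (M : Type*) [TopologicalSpace M]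
    [ChartedSpace H M] where
  /-- the fiber over a point -/
  Fib : M → Type*
  [addCommGroup : ∀ x, AddCommGroup (Fib x)]
  [module : ∀ x, Module ℝ (Fib x)]
  [topologicalSpace : ∀ x, TopologicalSpace (Fib x)]
  [isTopologicalAddGroup : ∀ x, IsTopologicalAddGroup (Fib x)]
  [continuousSMul : ∀ x, ContinuousSMul ℝ (Fib x)]
  [topologicalSpaceTotal : TopologicalSpace (TotalSpace ℝ Fib)]
  [fiberBundle : FiberBundle ℝ Fib]
  [vectorBundle : VectorBundle ℝ ℝ Fib]
  [contMDiffVectorBundle : ContMDiffVectorBundle ∞ ℝ Fib I]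

attribute [instance] LineBundle.addCommGroup LineBundle.module LineBundle.topologicalSpace
  LineBundle.isTopologicalAddGroup LineBundle.continuousSMul LineBundle.topologicalSpaceTotal
  LineBundle.fiberBundle LineBundle.vectorBundle LineBundle.contMDiffVectorBundle

namespace LineBundle

variable {I : ModelWithCorners ℝ E H} {M : Type*} [TopologicalSpace M] [ChartedSpace H M]
  {E' : Type*} [NormedAddCommGroup E'] [NormedSpace ℝ E']
  {H' : Type*} [TopologicalSpace H'] {I' : ModelWithCorners ℝ E' H'}
  {N : Type*} [TopologicalSpace N] [ChartedSpace H' N]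

/-- The smooth sections of `L`. -/
abbrev Sec (L : LineBundle I M) : Type _ := Cₛ^∞⟮I; ℝ, L.Fib⟯

/-- The total space of `L`. -/
abbrev Tot (L : LineBundle I M) : Type _ := TotalSpace ℝ L.Fib

/-- The pull-back line bundle. -/
def pullback (L : LineBundle I M) (f : C^∞⟮I', N; I, M⟯) : LineBundle I' N where
  Fib := f *ᵖ L.Fib
  addCommGroup x := inferInstanceAs (AddCommGroup (L.Fib (f x)))
  module x := inferInstanceAs (Module ℝ (L.Fib (f x)))
  topologicalSpace x := inferInstanceAs (TopologicalSpace (L.Fib (f x)))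
  isTopologicalAddGroup x := inferInstanceAs (IsTopologicalAddGroup (L.Fib (f x)))
  continuousSMul x := inferInstanceAs (ContinuousSMul ℝ (L.Fib (f x)))
  topologicalSpaceTotal := inferInstance
  fiberBundle := inferInstanceAs (FiberBundle ℝ ((f : N → M) *ᵖ L.Fib))
  vectorBundle := VectorBundle.pullback ℝ f
  contMDiffVectorBundle := ContMDiffVectorBundle.pullback ℝ L.Fib I' f

/-- The identity between the fibers over two equal points. -/
def castFib (L : LineBundle I M) {x y : M} (h : x = y) : L.Fib x ≃L[ℝ] L.Fib y :=
  h ▸ ContinuousLinearEquiv.refl ℝ (L.Fib x)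

theorem mk_castFib (L : LineBundle I M) {x y : M} (h : x = y) (v : L.Fib x) :
    (⟨y, L.castFib h v⟩ : L.Tot) = ⟨x, v⟩ := by
  subst h; rfl

/-- The product of a smooth function and a smooth section. -/
def fsmul (L : LineBundle I M) (f : C^∞⟮I, M; ℝ⟯) (lam : L.Sec) : L.Sec :=
  ⟨fun x => f x • lam x, f.contMDiff.smul_section lam.contMDiff⟩

/-- The fiber over `x` of the gauge algebroid `DL`: the `ℝ`-linear maps `Δ : Γ(L) → L_x` for which
there is a tangent vector `v` at `x` (the symbol of `Δ`) with `Δ(fλ) = v(f) λ_x + f(x) Δλ`. -/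
def D (L : LineBundle I M) (x : M) : Submodule ℝ (L.Sec →ₗ[ℝ] L.Fib x) where
  carrier := {Δ | ∃ v : TangentSpace I x, ∀ (f : C^∞⟮I, M; ℝ⟯) (lam : L.Sec),
    Δ (L.fsmul f lam) = mvfderiv I f x v • lam x + f x • Δ lam}
  add_mem' := by
    rintro Δ Δ' ⟨v, hv⟩ ⟨v', hv'⟩
    refine ⟨v + v', fun f lam => ?_⟩
    rw [LinearMap.add_apply, LinearMap.add_apply, hv, hv', map_add]
    module
  zero_mem' := ⟨0, fun f lam => by simp⟩
  smul_mem' := by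
    rintro c Δ ⟨v, hv⟩
    refine ⟨c • v, fun f lam => ?_⟩
    rw [LinearMap.smul_apply, LinearMap.smul_apply, hv, map_smul, smul_eq_mul]
    module

/-- The fiber over `x` of the first jet bundle `J¹L = Hom(DL, L)`. -/
abbrev J (L : LineBundle I M) (x : M) : Type _ := L.D x →ₗ[ℝ] L.Fib x

/-- A family of pointwise derivations is smooth if it maps smooth sections to smooth sections;
such families are the sections of `DL`, i.e. the derivations `Γ(L) → Γ(L)`. -/
def IsSmoothD (L : LineBundle I M) (Δ : ∀ x, L.D x) : Prop :=
  ∀ lam : L.Sec, ContMDiff I (I.prod 𝓘(ℝ, ℝ)) ∞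
    (fun x => (⟨x, (Δ x : L.Sec →ₗ[ℝ] L.Fib x) lam⟩ : L.Tot))

/-- Smooth sections of `J¹L = Hom(DL, L)`. -/
def IsSmoothJ (L : LineBundle I M) (ψ : ∀ x, L.J x) : Prop :=
  ∀ Δ : ∀ x, L.D x, L.IsSmoothD Δ → ContMDiff I (I.prod 𝓘(ℝ, ℝ)) ∞
    (fun x => (⟨x, ψ x (Δ x)⟩ : L.Tot))

/-- The fiber over `x` of `(DL)^{*⊗l} ⊗ (J¹L)^{*⊗m} ⊗ L`, seen as the space of multilinear maps
`(D_xL)^l × (J¹_xL)^m → L_x`. -/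
abbrev AtiyahFib (L : LineBundle I M) (l m : ℕ) (x : M) : Type _ :=
  MultilinearMap ℝ (fun _ : Fin l => L.D x) (MultilinearMap ℝ (fun _ : Fin m => L.J x) (L.Fib x))

/-- Atiyah `(l, m)`-tensors on `L`. -/
structure AtiyahTensor (L : LineBundle I M) (l m : ℕ) where
  /-- the value of the tensor at a point -/
  toFun : ∀ x, L.AtiyahFib l m x
  smooth : ∀ (Δ : Fin l → ∀ x, L.D x) (ψ : Fin m → ∀ x, L.J x),
    (∀ i, L.IsSmoothD (Δ i)) → (∀ j, L.IsSmoothJ (ψ j)) →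
    ContMDiff I (I.prod 𝓘(ℝ, ℝ)) ∞
      (fun x => (⟨x, toFun x (fun i => Δ i x) (fun j => ψ j x)⟩ : L.Tot))

/-- The fiber over `x` of the dual line bundle `L*`. -/
abbrev DualFib (L : LineBundle I M) (x : M) : Type _ := L.Fib x →L[ℝ] Trivial M ℝ x

/-- The total space of the dual line bundle `L*`. -/
abbrev Dual (L : LineBundle I M) : Type _ := TotalSpace (ℝ →L[ℝ] ℝ) L.DualFib

theorem isOpen_slit (L : LineBundle I M) : IsOpen {ε : L.Dual | ε.2 ≠ 0} := by
  rw [isOpen_iff_mem_nhds]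
  intro ε hε
  set e := trivializationAt (ℝ →L[ℝ] ℝ) L.DualFib ε.proj with he
  have hs : ε ∈ e.source := FiberBundle.mem_trivializationAt_proj_source
  have hz : ∀ δ ∈ e.source, (e δ).2 = 0 ↔ δ.2 = 0 := by
    intro δ hδ
    have hb : δ.proj ∈ e.baseSet := e.mem_source.1 hδ
    have := (e.continuousLinearEquivAt ℝ δ.proj hb).map_eq_zero_iff (x := δ.2)
    rwa [Bundle.Trivialization.continuousLinearEquivAt_apply] at this
  have hc : ContinuousAt (fun δ => (e δ).2) ε :=
    continuous_snd.continuousAt.comp (e.continuousOn.continuousAt (e.open_source.mem_nhds hs))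
  have hne : (e ε).2 ≠ 0 := fun h => hε ((hz ε hs).1 h)
  filter_upwards [hc.eventually_ne hne, e.open_source.mem_nhds hs] with δ h1 h2 h3
  exact h1 ((hz δ h2).2 h3)

/-- The slit dual bundle, as an open subset of `L*`. -/
def slit (L : LineBundle I M) : TopologicalSpace.Opens L.Dual := ⟨{ε | ε.2 ≠ 0}, L.isOpen_slit⟩

/-- The homogenization `M̃ = L* ∖ 0` of `L`. -/
abbrev Hgz (L : LineBundle I M) : Type _ := L.slit

/-- The projection `M̃ → M`. -/
def hproj (L : LineBundle I M) (ε : L.Hgz) : M := ε.1.proj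

/-- The point `ε` of `M̃`, seen as a linear form on the fiber of `L`. -/
def form (L : LineBundle I M) (ε : L.Hgz) : L.Fib (L.hproj ε) →L[ℝ] ℝ := ε.1.2

/-- The homogenization of a section of `L`: a function on `M̃`. -/
def hsec (L : LineBundle I M) (lam : L.Sec) (ε : L.Hgz) : ℝ := L.form ε (lam (L.hproj ε))

theorem contMDiff_hproj (L : LineBundle I M) :
    ContMDiff (I.prod 𝓘(ℝ, ℝ →L[ℝ] ℝ)) I ∞ L.hproj :=
  (contMDiff_proj L.DualFib).comp contMDiff_subtype_val

theorem contMDiff_hsec (L : LineBundle I M) (lam : L.Sec) :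
    ContMDiff (I.prod 𝓘(ℝ, ℝ →L[ℝ] ℝ)) 𝓘(ℝ, ℝ) ∞ (L.hsec lam) := by
  have h := ContMDiff.clm_bundle_apply (E₁ := L.Fib) (E₂ := Trivial M ℝ) (F₁ := ℝ) (F₂ := ℝ)
    (IB := I) (n := ∞) (IM := I.prod 𝓘(ℝ, ℝ →L[ℝ] ℝ)) (b := L.hproj)
    (ϕ := fun ε => ε.1.2) (v := fun ε => lam (L.hproj ε))
    (contMDiff_subtype_val) (lam.contMDiff.comp L.contMDiff_hproj)
  intro ε
  exact ((contMDiffAt_totalSpace).1 (h ε)).2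

theorem bijective_form (L : LineBundle I M) (ε : L.Hgz) : Function.Bijective (L.form ε) := by
  have hε : L.form ε ≠ 0 := ε.2
  set e := (trivializationAt ℝ L.Fib (L.hproj ε)).continuousLinearEquivAt ℝ (L.hproj ε)
    (FiberBundle.mem_baseSet_trivializationAt' _)
  have hsymm : ∀ v, v = e v • e.symm 1 := fun v => by
    rw [← map_smul, smul_eq_mul, mul_one, e.symm_apply_apply]
  have hne : L.form ε (e.symm 1) ≠ 0 := by
    intro h
    apply hε
    ext v
    rw [hsymm v, map_smul, h]; simp
  constructor
  · rw [injective_iff_map_eq_zero]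
    intro v hv
    rw [hsymm v, map_smul, smul_eq_mul] at hv
    have := (mul_eq_zero.1 hv).resolve_right hne
    rw [hsymm v, this, zero_smul]
  · intro r
    refine ⟨(r / L.form ε (e.symm 1)) • e.symm 1, ?_⟩
    rw [map_smul, smul_eq_mul, div_mul_cancel₀ _ hne]

/-- The canonical line bundle map `p_L : ℝ_M̃ → L`, given by `⟨ε, p_L(ε, r)⟩ = r`. -/
def pL (L : LineBundle I M) (ε : L.Hgz) : ℝ ≃ₗ[ℝ] L.Fib (L.hproj ε) :=
  (LinearEquiv.ofBijective (L.form ε : L.Fib (L.hproj ε) →ₗ[ℝ] ℝ) (L.bijective_form ε)).symm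

theorem form_pL (L : LineBundle I M) (ε : L.Hgz) (r : ℝ) : L.form ε (L.pL ε r) = r :=
  (LinearEquiv.ofBijective (L.form ε : L.Fib (L.hproj ε) →ₗ[ℝ] ℝ)
    (L.bijective_form ε)).apply_symm_apply r

theorem pL_form (L : LineBundle I M) (ε : L.Hgz) (v : L.Fib (L.hproj ε)) :
    L.pL ε (L.form ε v) = v :=
  (LinearEquiv.ofBijective (L.form ε : L.Fib (L.hproj ε) →ₗ[ℝ] ℝ)
    (L.bijective_form ε)).symm_apply_apply v

/-- The tangent space of the homogenization. -/
abbrev HT (L : LineBundle I M) (ε : L.Hgz) : Type _ :=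
  TangentSpace (I.prod 𝓘(ℝ, ℝ →L[ℝ] ℝ)) ε

theorem mdiff_hsec (L : LineBundle I M) (lam : L.Sec) (ε : L.Hgz) :
    MDifferentiableAt (I.prod 𝓘(ℝ, ℝ →L[ℝ] ℝ)) 𝓘(ℝ, ℝ) (L.hsec lam) ε :=
  (L.contMDiff_hsec lam).mdifferentiable (by simp) ε

/-- The vector bundle map `p_T : TM̃ → DL`, given by `⟨ε, p_T(v) λ⟩ = v(λ̃)`. -/
def pT (L : LineBundle I M) (ε : L.Hgz) : L.HT ε →ₗ[ℝ] L.D (L.hproj ε) where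
  toFun v := ⟨{
      toFun := fun lam => L.pL ε (mvfderiv (I.prod 𝓘(ℝ, ℝ →L[ℝ] ℝ)) (L.hsec lam) ε v)
      map_add' := by
        intro a b
        have h : L.hsec (a + b) = L.hsec a + L.hsec b := by
          funext δ; simp [hsec]
        rw [h, ← map_add, mvfderiv_add (L.mdiff_hsec a ε) (L.mdiff_hsec b ε)]
        rfl
      map_smul' := by
        intro c a
        have h : L.hsec (c • a) = (fun _ : L.Hgz => c) • L.hsec a := by
          funext δ; simp [hsec]
        rw [h, RingHom.id_apply, ← map_smul,
          mvfderiv_smul mdifferentiableAt_const (L.mdiff_hsec a ε), mvfderiv_const]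
        change L.pL ε (c • _ + (0 : ℝ) • L.hsec a ε) = _
        rw [zero_smul, add_zero]
        rfl }, by
    refine ⟨mfderiv (I.prod 𝓘(ℝ, ℝ →L[ℝ] ℝ)) I L.hproj ε v, fun f lam => ?_⟩
    have h : L.hsec (L.fsmul f lam) = (f ∘ L.hproj) • L.hsec lam := by
      funext δ; simp [hsec, fsmul]
    have hp : MDifferentiableAt (I.prod 𝓘(ℝ, ℝ →L[ℝ] ℝ)) I L.hproj ε :=
      L.contMDiff_hproj.mdifferentiable (by simp) ε
    have hf : MDifferentiableAt I 𝓘(ℝ, ℝ) f (L.hproj ε) :=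
      f.contMDiff.mdifferentiable (by simp) _
    have hl := L.pL_form ε (lam (L.hproj ε))
    simp only [LinearMap.coe_mk, AddHom.coe_mk]
    rw [h, mvfderiv_smul (hf.comp ε hp) (L.mdiff_hsec lam ε), mvfderiv_comp ε hf hp]
    change L.pL ε (f (L.hproj ε) • _ + mvfderiv I f (L.hproj ε) _ • L.form ε (lam (L.hproj ε))) = _
    rw [map_add, map_smul, map_smul, hl, add_comm]
    rfl⟩
  map_add' v w := by
    ext lam
    exact (congrArg (L.pL ε) (ContinuousLinearMap.map_add
      (mvfderiv (I.prod 𝓘(ℝ, ℝ →L[ℝ] ℝ)) (L.hsec lam) ε) v w)).trans (map_add (L.pL ε) _ _)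
  map_smul' c v := by
    ext lam
    exact (congrArg (L.pL ε) (ContinuousLinearMap.map_smul
      (mvfderiv (I.prod 𝓘(ℝ, ℝ →L[ℝ] ℝ)) (L.hsec lam) ε) c v)).trans
      (map_smul (L.pL ε) c _)

theorem pT_fsmul (L : LineBundle I M) (ε : L.Hgz) (w : L.HT ε) (f : C^∞⟮I, M; ℝ⟯) (lam : L.Sec) :
    (L.pT ε w : L.Sec →ₗ[ℝ] L.Fib (L.hproj ε)) (L.fsmul f lam) =
      mvfderiv I f (L.hproj ε) (mfderiv (I.prod 𝓘(ℝ, ℝ →L[ℝ] ℝ)) I L.hproj ε w) •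
        lam (L.hproj ε) + f (L.hproj ε) • (L.pT ε w : L.Sec →ₗ[ℝ] L.Fib (L.hproj ε)) lam := by
  have h : L.hsec (L.fsmul f lam) = (f ∘ L.hproj) • L.hsec lam := by
    funext δ; simp [hsec, fsmul]
  have hp : MDifferentiableAt (I.prod 𝓘(ℝ, ℝ →L[ℝ] ℝ)) I L.hproj ε :=
    L.contMDiff_hproj.mdifferentiable (by simp) ε
  have hf : MDifferentiableAt I 𝓘(ℝ, ℝ) f (L.hproj ε) :=
    f.contMDiff.mdifferentiable (by simp) _
  have hl := L.pL_form ε (lam (L.hproj ε))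
  change L.pL ε (mvfderiv (I.prod 𝓘(ℝ, ℝ →L[ℝ] ℝ)) (L.hsec (L.fsmul f lam)) ε w) = _
  rw [h, mvfderiv_smul (hf.comp ε hp) (L.mdiff_hsec lam ε), mvfderiv_comp ε hf hp]
  change L.pL ε (f (L.hproj ε) • _ + mvfderiv I f (L.hproj ε) _ • L.form ε (lam (L.hproj ε))) = _
  rw [map_add, map_smul, map_smul, hl, add_comm]
  rfl

/-- Derivations are determined by symbol and value on a local frame. -/
theorem D_formula (L : LineBundle I M) {x : M} {ψ f : C^∞⟮I, M; ℝ⟯} {s lam : L.Sec}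
    (hψ : ∀ᶠ y in 𝓝 x, ψ y = 1) (h : L.fsmul f s = L.fsmul ψ lam)
    (Δ : L.Sec →ₗ[ℝ] L.Fib x) (v : TangentSpace I x)
    (hv : ∀ (f : C^∞⟮I, M; ℝ⟯) (lam : L.Sec),
      Δ (L.fsmul f lam) = mvfderiv I f x v • lam x + f x • Δ lam) :
    Δ lam = mvfderiv I f x v • s x + f x • Δ s := by
  have h0 : mvfderiv I ψ x v = 0 := by
    have : (ψ : M → ℝ) =ᶠ[𝓝 x] fun _ => 1 := hψ
    have h1 : mfderiv I 𝓘(ℝ, ℝ) ψ x = mfderiv I 𝓘(ℝ, ℝ) (fun _ : M => (1 : ℝ)) x :=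
      this.mfderiv_eq
    rw [mfderiv_const] at h1
    change (mfderiv I 𝓘(ℝ, ℝ) ψ x v : ℝ) = 0
    exact congrArg (fun F => F v) h1
  have h1 := hv ψ lam
  rw [← h, hv f s, h0, hψ.self_of_nhds, zero_smul, zero_add, one_smul] at h1
  exact h1.symm

section

variable [IsManifold I ∞ M]

theorem hgz_eq_zero (L : LineBundle I M) (ε : L.Hgz) (w : L.HT ε) {s : L.Sec}
    (hs : ∀ᶠ y in 𝓝 (L.hproj ε), s y = (trivializationAt ℝ L.Fib (L.hproj ε)).symm y 1)
    (h1 : mfderiv (I.prod 𝓘(ℝ, ℝ →L[ℝ] ℝ)) I L.hproj ε w = 0)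
    (h2 : mvfderiv (I.prod 𝓘(ℝ, ℝ →L[ℝ] ℝ)) (L.hsec s) ε w = 0) : w = 0 := by
  set x := L.hproj ε
  set J := I.prod 𝓘(ℝ, ℝ →L[ℝ] ℝ)
  have hp : MDifferentiableAt J I L.hproj ε :=
    L.contMDiff_hproj.mdifferentiable (by simp) ε
  obtain ⟨A, hA⟩ := (isInvertible_mfderiv_extChartAt (I := J) (mem_extChartAt_source (I := J) ε))
  let F : L.Hgz → E × (ℝ →L[ℝ] ℝ) := fun δ =>
    (extChartAt I x (L.hproj δ), ContinuousLinearMap.toSpanSingleton ℝ (ContinuousLinearMap.id ℝ ℝ) (L.hsec s δ))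
  have hev : extChartAt J ε =ᶠ[𝓝 ε] F := by
    have hc := L.contMDiff_hproj.continuous.continuousAt (x := ε)
    filter_upwards [hc.eventually hs, hc.preimage_mem_nhds
      ((trivializationAt ℝ L.Fib x).open_baseSet.mem_nhds
        (FiberBundle.mem_baseSet_trivializationAt' x))] with δ hδ hδ'
    change (extChartAt I x (L.hproj δ), (trivializationAt (ℝ →L[ℝ] ℝ) L.DualFib x δ.1).2) = _
    refine Prod.ext rfl ?_
    ext
    change (trivializationAt ℝ (Trivial M ℝ) x).continuousLinearMapAt ℝ (L.hproj δ)
      (δ.1.2 ((trivializationAt ℝ L.Fib x).symmL ℝ (L.hproj δ) 1)) =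
      L.form δ (s (L.hproj δ)) • (1 : ℝ)
    rw [Bundle.Trivialization.symmL_apply _ hδ', hδ, smul_eq_mul, mul_one]
    simp
    rfl
  suffices hz : mfderiv J 𝓘(ℝ, E × (ℝ →L[ℝ] ℝ)) (extChartAt J ε) ε w = 0 by
    rw [← hA] at hz
    exact A.map_eq_zero_iff.1 hz
  have d1 : HasMFDerivAt J 𝓘(ℝ, E) (fun δ => extChartAt I x (L.hproj δ)) ε _ :=
    (mdifferentiableAt_extChartAt (I := I) (mem_chart_source H x)).hasMFDerivAt.comp ε
      hp.hasMFDerivAt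
  have d2 : HasMFDerivAt J 𝓘(ℝ, ℝ →L[ℝ] ℝ) (fun δ =>
      ContinuousLinearMap.toSpanSingleton ℝ (ContinuousLinearMap.id ℝ ℝ) (L.hsec s δ)) ε _ :=
    (ContinuousLinearMap.hasMFDerivAt
      (ContinuousLinearMap.toSpanSingleton ℝ (ContinuousLinearMap.id ℝ ℝ))).comp ε
      (L.mdiff_hsec s ε).hasMFDerivAt
  have d3 : MDifferentiableAt J 𝓘(ℝ, E × (ℝ →L[ℝ] ℝ)) F ε :=
    d1.mdifferentiableAt.prodMk_space d2.mdifferentiableAt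
  have f1 := (ContinuousLinearMap.hasMFDerivAt (ContinuousLinearMap.fst ℝ E (ℝ →L[ℝ] ℝ))
    (x := F ε)).comp ε d3.hasMFDerivAt
  have f2 := (ContinuousLinearMap.hasMFDerivAt (ContinuousLinearMap.snd ℝ E (ℝ →L[ℝ] ℝ))
    (x := F ε)).comp ε d3.hasMFDerivAt
  have e1 := congrArg (fun A => A w) (hasMFDerivAt_unique f1 d1)
  have e2 := congrArg (fun A => A w) (hasMFDerivAt_unique f2 d2)
  rw [hev.mfderiv_eq]
  refine Prod.ext (e1.trans ?_) (e2.trans ?_)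
  · change mfderiv I 𝓘(ℝ, E) (extChartAt I x) x (mfderiv J I L.hproj ε w) = 0
    rw [h1, map_zero]
  · change ContinuousLinearMap.toSpanSingleton ℝ (ContinuousLinearMap.id ℝ ℝ)
      (mvfderiv J (L.hsec s) ε w) = 0
    rw [h2, map_zero]

variable [FiniteDimensional ℝ E] [T2Space M]

theorem exists_frame (L : LineBundle I M) (x : M) : ∃ (s : L.Sec) (ψ : C^∞⟮I, M; ℝ⟯),
    (∀ᶠ y in 𝓝 x, ψ y = 1) ∧
    (∀ᶠ y in 𝓝 x, s y = (trivializationAt ℝ L.Fib x).symm y 1) ∧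
    (∀ lam : L.Sec, ∃ f : C^∞⟮I, M; ℝ⟯, L.fsmul f s = L.fsmul ψ lam) := by
  set e := trivializationAt ℝ L.Fib x with he
  have hx : x ∈ e.baseSet := FiberBundle.mem_baseSet_trivializationAt' x
  obtain ⟨φ, hφ⟩ := (SmoothBumpFunction.nhds_basis_tsupport (I := I) x).mem_iff.1
    (e.open_baseSet.mem_nhds hx)
  have hφt : tsupport φ ⊆ e.baseSet := hφ.2
  have hframe : ContMDiffOn I (I.prod 𝓘(ℝ, ℝ)) ∞
      (fun y => (⟨y, e.symm y 1⟩ : L.Tot)) e.baseSet := by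
    have h1 := (e.contMDiffOn_symm (IB := I) (n := ∞)).comp
      (contMDiffOn_id.prodMk (contMDiffOn_const (c := (1 : ℝ)) (s := e.baseSet) (I := I)))
      (fun y hy => by rw [mem_preimage, e.target_eq]; exact ⟨hy, mem_univ _⟩)
    refine h1.congr fun y hy => ?_
    simp only [Function.comp_apply, id_eq]
    rw [← e.mk_symm hy]
  have hs : ContMDiff I (I.prod 𝓘(ℝ, ℝ)) ∞
      (fun y => (⟨y, ((φ : M → ℝ) • fun y => (e.symm y 1 : L.Fib y)) y⟩ : L.Tot)) :=
    ContMDiffOn.smul_section_of_tsupport (φ.contMDiff.contMDiffOn) e.open_baseSet hφt hframe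
  set ψ : C^∞⟮I, M; ℝ⟯ := ⟨fun y => φ y * φ y, φ.contMDiff.mul φ.contMDiff⟩ with hψ
  refine ⟨⟨_, hs⟩, ψ, ?_, ?_, fun lam => ?_⟩
  · filter_upwards [φ.eventuallyEq_one] with y hy
    change φ y * φ y = 1
    rw [hy]; simp
  · filter_upwards [φ.eventuallyEq_one] with y hy
    change φ y • (e.symm y 1 : L.Fib y) = _
    rw [hy]; simp
  · have hc : ContMDiffOn I 𝓘(ℝ, ℝ) ∞ (fun y => (e ⟨y, lam y⟩).2) e.baseSet :=
      (e.contMDiffOn_section_baseSet_iff).1 lam.contMDiff.contMDiffOn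
    have hf : ContMDiff I 𝓘(ℝ, ℝ) ∞ (fun y => φ y • (e ⟨y, lam y⟩).2) := by
      refine contMDiff_of_tsupport fun y hy => ?_
      have hy' : y ∈ e.baseSet := hφt (closure_mono (Function.support_smul_subset_left _ _) hy)
      exact φ.contMDiffAt.smul (hc.contMDiffAt (e.open_baseSet.mem_nhds hy'))
    refine ⟨⟨_, hf⟩, ?_⟩
    ext y
    change (φ y • (e ⟨y, lam y⟩).2) • (φ y • (e.symm y 1 : L.Fib y)) = (φ y * φ y) • lam y
    by_cases hy : y ∈ e.baseSet
    · set A := e.continuousLinearEquivAt ℝ y hy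
      have h1 : (e ⟨y, lam y⟩).2 = A (lam y) := rfl
      have h2 : e.symm y 1 = A.symm 1 := by
        simp only [A, Bundle.Trivialization.symm_continuousLinearEquivAt_eq]
        rw [Bundle.Trivialization.symmL_apply e hy]
      have h3 : lam y = A (lam y) • A.symm 1 := by
        rw [← map_smul, smul_eq_mul, mul_one, A.symm_apply_apply]
      rw [h1, h2]
      conv_rhs => rw [h3]
      rw [smul_smul, smul_smul, smul_eq_mul]
      congr 1; ring
    · have : φ y = 0 := by
        by_contra h
        exact hy (hφt (subset_tsupport _ h))
      rw [this]; simp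

theorem eq_zero_of_mvfderiv {x : M} (v : TangentSpace I x)
    (h : ∀ f : C^∞⟮I, M; ℝ⟯, mvfderiv I f x v = 0) : v = 0 := by
  have hinv := (isInvertible_mfderiv_extChartAt (I := I) (mem_extChartAt_source (I := I) x))
  obtain ⟨A, hA⟩ := hinv
  obtain ⟨φ⟩ : Nonempty (SmoothBumpFunction I x) := inferInstance
  obtain ⟨z, hz⟩ : ∃ z : E, z = mfderiv I 𝓘(ℝ, E) (extChartAt I x) x v := ⟨_, rfl⟩
  suffices h0 : z = 0 by
    rw [hz, ← hA] at h0
    exact A.map_eq_zero_iff.1 h0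
  by_contra hne
  obtain ⟨ℓ, -, hℓ⟩ := exists_dual_vector ℝ z (norm_ne_zero_iff.2 hne)
  have hf : ContMDiff I 𝓘(ℝ, ℝ) ∞ (fun y => φ y • ℓ (extChartAt I x y)) :=
    φ.contMDiff_smul ((ℓ.contMDiff).comp_contMDiffOn contMDiffOn_extChartAt)
  have h1 := h ⟨_, hf⟩
  have h2 : (fun y => φ y • ℓ (extChartAt I x y)) =ᶠ[𝓝 x] ℓ ∘ extChartAt I x := by
    filter_upwards [φ.eventuallyEq_one] with y hy
    rw [hy]; simp
  have h3 : mvfderiv I (fun y => φ y • ℓ (extChartAt I x y)) x v = ℓ z := by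
    change (mfderiv I 𝓘(ℝ, ℝ) _ x v : ℝ) = _
    rw [h2.mfderiv_eq, mfderiv_comp x (ℓ.differentiableAt.mdifferentiableAt)
      (mdifferentiableAt_extChartAt (mem_chart_source H x)), hz]
    rw [mfderiv_eq_fderiv, ContinuousLinearMap.fderiv]
    rfl
  have h4 : ℓ z = 0 := h3.symm.trans h1
  rw [hℓ] at h4
  exact hne (norm_eq_zero.1 (by exact_mod_cast h4))

theorem pT_bijective (L : LineBundle I M) (ε : L.Hgz) : Function.Bijective (L.pT ε) := by
  set x := L.hproj ε with hx
  set J := I.prod 𝓘(ℝ, ℝ →L[ℝ] ℝ) with hJ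
  obtain ⟨s, ψ, hψ, hs, hf⟩ := L.exists_frame x
  have hsx : s x ≠ 0 := by
    rw [hs.self_of_nhds]
    have hxb : x ∈ (trivializationAt ℝ L.Fib x).baseSet :=
      FiberBundle.mem_baseSet_trivializationAt' x
    set A := (trivializationAt ℝ L.Fib x).continuousLinearEquivAt ℝ x hxb
    have h2 : (trivializationAt ℝ L.Fib x).symm x 1 = A.symm 1 := by
      simp only [A, Bundle.Trivialization.symm_continuousLinearEquivAt_eq]
      rw [Bundle.Trivialization.symmL_apply _ hxb]
    rw [h2]
    simp
  let K : L.HT ε →ₗ[ℝ] TangentSpace I x × ℝ :=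
    (mfderiv J I L.hproj ε).toLinearMap.prod (mvfderiv J (L.hsec s) ε).toLinearMap
  have hK : Function.Injective K := by
    rw [injective_iff_map_eq_zero]
    intro w hw
    exact L.hgz_eq_zero ε w hs (congrArg Prod.fst hw) (congrArg Prod.snd hw)
  have hKs : Function.Surjective K := by
    have : FiniteDimensional ℝ (L.HT ε) :=
      inferInstanceAs (FiniteDimensional ℝ (E × (ℝ →L[ℝ] ℝ)))
    have : FiniteDimensional ℝ (TangentSpace I x) := inferInstanceAs (FiniteDimensional ℝ E)
    refine (LinearMap.injective_iff_surjective_of_finrank_eq_finrank ?_).1 hK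
    rw [Module.finrank_prod]
    change Module.finrank ℝ (E × (ℝ →L[ℝ] ℝ)) = Module.finrank ℝ E + _
    rw [Module.finrank_prod]
    congr 1
    rw [← (LinearMap.toContinuousLinearMap (𝕜 := ℝ) (E := ℝ) (F' := ℝ)).finrank_eq]
    simp
  have hval : ∀ w, (L.pT ε w : L.Sec →ₗ[ℝ] L.Fib x) s = L.pL ε (mvfderiv J (L.hsec s) ε w) :=
    fun w => rfl
  constructor
  · rw [injective_iff_map_eq_zero]
    intro w hw
    have h2 : mvfderiv J (L.hsec s) ε w = 0 := by
      have := hval w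
      rw [hw] at this
      exact (L.pL ε).map_eq_zero_iff.1 this.symm
    refine L.hgz_eq_zero ε w hs (eq_zero_of_mvfderiv _ fun f => ?_) h2
    have := L.pT_fsmul ε w f s
    rw [hw] at this
    simp only [ZeroMemClass.coe_zero, LinearMap.zero_apply, smul_zero, add_zero] at this
    exact (smul_eq_zero.1 this.symm).resolve_right hsx
  · rintro ⟨Δ, v, hv⟩
    obtain ⟨w, hw⟩ := hKs (v, L.form ε (Δ s))
    have hw1 : mfderiv J I L.hproj ε w = v := congrArg Prod.fst hw
    have hw2 : mvfderiv J (L.hsec s) ε w = L.form ε (Δ s) := congrArg Prod.snd hw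
    refine ⟨w, ?_⟩
    ext lam
    obtain ⟨f, hfl⟩ := hf lam
    rw [L.D_formula hψ hfl Δ v hv]
    refine (L.D_formula hψ hfl _ _ (L.pT_fsmul ε w)).trans ?_
    rw [hw1, hval, hw2, L.pL_form]

/-- The vector bundle map `p_{T*} : T*M̃ → J¹L`, given by `⟨ε, p_{T*}(θ)(p_T(v))⟩ = θ(v)`. -/
def pTstar (L : LineBundle I M) (ε : L.Hgz) : (L.HT ε →L[ℝ] ℝ) →ₗ[ℝ] L.J (L.hproj ε) where
  toFun θ := (L.pL ε : ℝ →ₗ[ℝ] L.Fib (L.hproj ε)) ∘ₗ (θ : L.HT ε →ₗ[ℝ] ℝ) ∘ₗ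
    ((LinearEquiv.ofBijective (L.pT ε) (L.pT_bijective ε)).symm : L.D (L.hproj ε) →ₗ[ℝ] L.HT ε)
  map_add' θ θ' := by ext Δ; simp
  map_smul' c θ := by ext Δ; exact map_smul (L.pL ε) c _

theorem form_pTstar_pT (L : LineBundle I M) (ε : L.Hgz) (θ : L.HT ε →L[ℝ] ℝ) (v : L.HT ε) :
    L.form ε (L.pTstar ε θ (L.pT ε v)) = θ v :=
  (L.form_pL ε _).trans (congrArg θ
    ((LinearEquiv.ofBijective (L.pT ε) (L.pT_bijective ε)).symm_apply_apply v))

end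

end LineBundle

/-- A (regular) line bundle map: a smooth vector bundle map which is an isomorphism on fibers. -/
structure LineBundleMap {E : Type*} [NormedAddCommGroup E] [NormedSpace ℝ E]
    {H : Type*} [TopologicalSpace H] {I : ModelWithCorners ℝ E H}
    {M : Type*} [TopologicalSpace M] [ChartedSpace H M]
    {E' : Type*} [NormedAddCommGroup E'] [NormedSpace ℝ E']
    {H' : Type*} [TopologicalSpace H'] {I' : ModelWithCorners ℝ E' H'}
    {N : Type*} [TopologicalSpace N] [ChartedSpace H' N]
    (LN : LineBundle I' N) (L : LineBundle I M) where
  /-- the map between the bases -/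
  base : C^∞⟮I', N; I, M⟯
  /-- the isomorphisms between the fibers -/
  fib : ∀ y, LN.Fib y ≃L[ℝ] L.Fib (base y)
  smooth : ContMDiff (I'.prod 𝓘(ℝ, ℝ)) (I.prod 𝓘(ℝ, ℝ)) ∞
    (fun v : LN.Tot => (⟨base v.1, fib v.1 v.2⟩ : L.Tot))

namespace LineBundleMap

variable {I : ModelWithCorners ℝ E H} {M : Type*} [TopologicalSpace M] [ChartedSpace H M]
  {E' : Type*} [NormedAddCommGroup E'] [NormedSpace ℝ E']
  {H' : Type*} [TopologicalSpace H'] {I' : ModelWithCorners ℝ E' H'}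
  {N : Type*} [TopologicalSpace N] [ChartedSpace H' N]
  {LN : LineBundle I' N} {L : LineBundle I M}

theorem contMDiff_pullSec [IsManifold I' ∞ N] (φ : LineBundleMap LN L) (lam : L.Sec) :
    ContMDiff I' (I'.prod 𝓘(ℝ, ℝ)) ∞
      (fun y => (⟨y, (φ.fib y).symm (lam (φ.base y))⟩ : LN.Tot)) := by
  intro y₀
  rw [contMDiffAt_section]
  set e := trivializationAt ℝ LN.Fib y₀ with he
  set e' := trivializationAt ℝ L.Fib (φ.base y₀) with he'
  have hy₀ : y₀ ∈ e.baseSet := FiberBundle.mem_baseSet_trivializationAt' y₀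
  have hφ₀ : φ.base y₀ ∈ e'.baseSet := FiberBundle.mem_baseSet_trivializationAt' _
  have h1 : ContMDiffAt I' (I'.prod 𝓘(ℝ, ℝ)) ∞
      (fun y => (⟨y, e.symm y 1⟩ : LN.Tot)) y₀ := by
    have := (e.contMDiffOn_symm (IB := I') (n := ∞)).contMDiffAt (x := (y₀, (1 : ℝ)))
      (e.open_target.mem_nhds (by rw [e.target_eq]; exact ⟨hy₀, mem_univ _⟩))
    have h2 := this.comp y₀ (contMDiffAt_id.prodMk contMDiffAt_const)
    refine h2.congr_of_eventuallyEq ?_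
    filter_upwards [e.open_baseSet.mem_nhds hy₀] with y hy
    simp only [Function.comp_apply, id_eq]
    rw [← e.mk_symm hy]
  set a : N → ℝ := fun y => (e' ⟨φ.base y, φ.fib y (e.symm y 1)⟩).2 with ha
  set b : N → ℝ := fun y => (e' ⟨φ.base y, lam (φ.base y)⟩).2 with hb
  have hsa : ContMDiffAt I' 𝓘(ℝ, ℝ) ∞ a y₀ := by
    have := ContMDiffAt.comp y₀ (φ.smooth.contMDiffAt (x := ⟨y₀, e.symm y₀ 1⟩)) h1
    exact (contMDiffAt_totalSpace.1 this).2
  have hsb : ContMDiffAt I' 𝓘(ℝ, ℝ) ∞ b y₀ := by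
    have := ContMDiffAt.comp y₀ (lam.contMDiff.contMDiffAt (x := φ.base y₀))
      φ.base.contMDiff.contMDiffAt
    exact (contMDiffAt_totalSpace.1 this).2
  have key : ∀ y ∈ e.baseSet, φ.base y ∈ e'.baseSet → a y ≠ 0 ∧
      (e ⟨y, (φ.fib y).symm (lam (φ.base y))⟩).2 = (a y)⁻¹ * b y := by
    intro y hy hy'
    set A := e.continuousLinearEquivAt ℝ y hy
    set B := e'.continuousLinearEquivAt ℝ (φ.base y) hy'
    have haA : a y = B (φ.fib y (A.symm 1)) := by
      simp only [ha, A, B, Bundle.Trivialization.continuousLinearEquivAt_apply,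
        Bundle.Trivialization.symm_continuousLinearEquivAt_eq]
      rw [Bundle.Trivialization.symmL_apply e hy]
    have hbB : b y = B (lam (φ.base y)) := rfl
    have hcA : (e ⟨y, (φ.fib y).symm (lam (φ.base y))⟩).2
        = A ((φ.fib y).symm (lam (φ.base y))) := rfl
    have hne : a y ≠ 0 := by
      rw [haA]
      simp
    refine ⟨hne, ?_⟩
    rw [hcA, hbB, eq_inv_mul_iff_mul_eq₀ hne, haA]
    set w := (φ.fib y).symm (lam (φ.base y)) with hw
    have hlw : lam (φ.base y) = φ.fib y w := by simp [hw]
    have hwA : w = A w • A.symm 1 := by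
      rw [← map_smul, smul_eq_mul, mul_one, A.symm_apply_apply]
    rw [hlw]
    conv_rhs => rw [hwA, map_smul, map_smul, smul_eq_mul, mul_comm]
  refine ((hsa.inv₀ (key y₀ hy₀ hφ₀).1).mul hsb).congr_of_eventuallyEq ?_
  filter_upwards [e.open_baseSet.mem_nhds hy₀,
    φ.base.contMDiff.continuous.continuousAt.preimage_mem_nhds
      (e'.open_baseSet.mem_nhds hφ₀)] with y hy hy'
  exact (key y hy hy').2

/-- The pull-back `φ^*λ` of a section. -/
def pullSec [IsManifold I' ∞ N] (φ : LineBundleMap LN L) (lam : L.Sec) : LN.Sec :=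
  ⟨fun y => (φ.fib y).symm (lam (φ.base y)), φ.contMDiff_pullSec lam⟩

/-- The map `Dφ : DL_N → DL` induced by a line bundle map, `Dφ(Δ) λ = φ(Δ(φ^*λ))`, on the fiber
over a point. -/
def D [IsManifold I' ∞ N] (φ : LineBundleMap LN L) (y : N) : LN.D y →ₗ[ℝ] L.D (φ.base y) where
  toFun Δ := ⟨{
      toFun := fun lam => φ.fib y ((Δ : LN.Sec →ₗ[ℝ] LN.Fib y) (φ.pullSec lam))
      map_add' := by
        intro a b
        have h : φ.pullSec (a + b) = φ.pullSec a + φ.pullSec b := by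
          ext z; simp [pullSec]
        rw [h, map_add, map_add]
      map_smul' := by
        intro c a
        have h : φ.pullSec (c • a) = c • φ.pullSec a := by
          ext z; simp [pullSec]
        rw [h, map_smul, map_smul, RingHom.id_apply] }, by
    obtain ⟨Δ, v, hv⟩ := Δ
    refine ⟨mfderiv I' I φ.base y v, fun f lam => ?_⟩
    have h : φ.pullSec (L.fsmul f lam) = LN.fsmul (f.comp φ.base) (φ.pullSec lam) := by
      ext z; simp [pullSec, LineBundle.fsmul]
    have hd : mvfderiv I' (f.comp φ.base) y v
        = mvfderiv I f (φ.base y) (mfderiv I' I φ.base y v) :=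
      mvfderiv_comp_apply y (f.contMDiff.mdifferentiable (by simp) _)
        (φ.base.contMDiff.mdifferentiable (by simp) _) v
    simp only [LinearMap.coe_mk, AddHom.coe_mk]
    rw [h, hv, map_add, map_smul, map_smul, hd]
    simp [pullSec]⟩
  map_add' Δ Δ' := by
    ext lam
    simp
  map_smul' c Δ := by
    ext lam
    simp

/-- The map `Dφ : DL_N → DL` on total spaces. -/
def DTot [IsManifold I' ∞ N] (φ : LineBundleMap LN L) (Δ : Σ y, LN.D y) : Σ x, L.D x :=
  ⟨φ.base Δ.1, φ.D Δ.1 Δ.2⟩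

/-- The homogenization `φ̃ : Ñ → M̃` of a line bundle map: the restriction to the slit dual bundles
of the fiberwise inverse of the transpose of `φ`. -/
def hgz (φ : LineBundleMap LN L) (ε : LN.Hgz) : L.Hgz :=
  ⟨⟨φ.base (LN.hproj ε),
    (LN.form ε).comp ((φ.fib (LN.hproj ε)).symm : L.Fib (φ.base (LN.hproj ε)) →L[ℝ] _)⟩, by
    intro h
    apply ε.2
    ext v
    have h' : LN.form ε ((φ.fib (LN.hproj ε)).symm (φ.fib (LN.hproj ε) v)) = 0 :=
      congrArg (fun f => f (φ.fib (LN.hproj ε) v)) h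
    exact (congrArg (LN.form ε) ((φ.fib (LN.hproj ε)).symm_apply_apply v)).symm.trans h'⟩

end LineBundleMap
end LineBundles

section Groupoids

variable {EM : Type*} [NormedAddCommGroup EM] [NormedSpace ℝ EM]
  {HM : Type*} [TopologicalSpace HM] {IM : ModelWithCorners ℝ EM HM}
  {M : Type*} [TopologicalSpace M] [ChartedSpace HM M]
  {EG : Type*} [NormedAddCommGroup EG] [NormedSpace ℝ EG]
  {HG : Type*} [TopologicalSpace HG] {IG : ModelWithCorners ℝ EG HG}
  {G : Type*} [TopologicalSpace G] [ChartedSpace HG G]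
  {EP : Type*} [NormedAddCommGroup EP] [NormedSpace ℝ EP]
  {HP : Type*} [TopologicalSpace HP] {IP : ModelWithCorners ℝ EP HP}
  {P : Type*} [TopologicalSpace P] [ChartedSpace HP P]

/-! ### Tensors and their homogenization -/

/-- The fiber over `x` of the tensor bundle `(T*M)^{⊗l} ⊗ (TM)^{⊗m}`, seen as the space of
multilinear maps `(T_xM)^l × (T*_xM)^m → ℝ`. -/
abbrev TensorFib (IM : ModelWithCorners ℝ EM HM) {M : Type*} [TopologicalSpace M]
    [ChartedSpace HM M] (l m : ℕ) (x : M) : Type _ :=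
  MultilinearMap ℝ (fun _ : Fin l => TangentSpace IM x)
    (MultilinearMap ℝ (fun _ : Fin m => TangentSpace IM x →L[ℝ] ℝ) ℝ)

/-- The homogenization `T̃` of an Atiyah `(l, m)`-tensor `T`, an `(l, m)`-tensor on `M̃`:
`T̃(v₁, …, v_l; θ₁, …, θ_m) = ⟨ε, T(p_T v₁, …, p_T v_l; p_{T*} θ₁, …, p_{T*} θ_m)⟩`
for `v_i` in `T_εM̃` and `θ_j` in `T*_εM̃`. -/
def LineBundle.AtiyahTensor.hgz [FiniteDimensional ℝ EM] [IsManifold IM ∞ M] [T2Space M]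
    {L : LineBundle IM M} {l m : ℕ} (T : L.AtiyahTensor l m)
    (ε : L.Hgz) : TensorFib (IM.prod 𝓘(ℝ, ℝ →L[ℝ] ℝ)) l m ε :=
  LinearMap.compMultilinearMap
    { toFun := fun S : MultilinearMap ℝ (fun _ : Fin m => L.J (L.hproj ε)) (L.Fib (L.hproj ε)) =>
        (L.form ε : L.Fib (L.hproj ε) →ₗ[ℝ] ℝ).compMultilinearMap
          (S.compLinearMap (fun _ => L.pTstar ε))
      map_add' := fun S S' => by ext; simp
      map_smul' := fun c S => by ext; simp }
    ((T.toFun (L.hproj ε)).compLinearMap (fun _ => L.pT ε))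

theorem LineBundle.AtiyahTensor.hgz_apply [FiniteDimensional ℝ EM] [IsManifold IM ∞ M]
    [T2Space M] {L : LineBundle IM M} {l m : ℕ} (T : L.AtiyahTensor l m)
    (ε : L.Hgz) (v : Fin l → L.HT ε) (θ : Fin m → (L.HT ε →L[ℝ] ℝ)) :
    T.hgz ε v θ = L.form ε
      (T.toFun (L.hproj ε) (fun i => L.pT ε (v i)) (fun j => L.pTstar ε (θ j))) := rfl

/-! ### Lie groupoids, tangent and cotangent groupoids -/

/-- The structure maps of a groupoid `G ⇉ M` whose space of composable pairs is `P`. -/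
structure GroupoidMaps (M G P : Type*) where
  /-- source -/
  src : G → M
  /-- target -/
  tgt : G → M
  /-- first projection of a composable pair -/
  pr₁ : P → G
  /-- second projection of a composable pair -/
  pr₂ : P → G
  /-- multiplication -/
  mul : P → G
  /-- units -/
  one : M → G
  /-- inversion -/
  inv : G → G

/-- A Lie groupoid `G ⇉ M`. The fibered product `G ₛ×ₜ G` of composable pairs `(g, h)`,
`s(g) = t(h)`, is presented as a manifold `P` embedded in `G × G` by its two projections. -/
structure LieGroupoid (IM : ModelWithCorners ℝ EM HM) (M : Type*) [TopologicalSpace M]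
    [ChartedSpace HM M] (IG : ModelWithCorners ℝ EG HG) (G : Type*) [TopologicalSpace G]
    [ChartedSpace HG G] (IP : ModelWithCorners ℝ EP HP) (P : Type*) [TopologicalSpace P]
    [ChartedSpace HP P] where
  /-- source -/
  src : C^∞⟮IG, G; IM, M⟯
  /-- target -/
  tgt : C^∞⟮IG, G; IM, M⟯
  /-- first projection of a composable pair -/
  pr₁ : C^∞⟮IP, P; IG, G⟯
  /-- second projection of a composable pair -/
  pr₂ : C^∞⟮IP, P; IG, G⟯
  /-- multiplication -/
  mul : C^∞⟮IP, P; IG, G⟯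
  /-- units -/
  one : C^∞⟮IM, M; IG, G⟯
  /-- inversion -/
  inv : C^∞⟮IG, G; IG, G⟯
  src_submersion : Manifold.IsSubmersion IG IM ∞ src
  tgt_submersion : Manifold.IsSubmersion IG IM ∞ tgt
  pair_embedding : Manifold.IsSmoothEmbedding IP (IG.prod IG) ∞ (fun c => (pr₁ c, pr₂ c))
  src_pr₁ : ∀ c, src (pr₁ c) = tgt (pr₂ c)
  exists_pair : ∀ g h, src g = tgt h → ∃ c, pr₁ c = g ∧ pr₂ c = h
  src_mul : ∀ c, src (mul c) = src (pr₂ c)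
  tgt_mul : ∀ c, tgt (mul c) = tgt (pr₁ c)
  src_one : ∀ x, src (one x) = x
  tgt_one : ∀ x, tgt (one x) = x
  src_inv : ∀ g, src (inv g) = tgt g
  tgt_inv : ∀ g, tgt (inv g) = src g
  one_mul : ∀ c, pr₁ c = one (tgt (pr₂ c)) → mul c = pr₂ c
  mul_one : ∀ c, pr₂ c = one (src (pr₁ c)) → mul c = pr₁ c
  inv_mul : ∀ c, pr₁ c = inv (pr₂ c) → mul c = one (src (pr₂ c))
  mul_inv : ∀ c, pr₂ c = inv (pr₁ c) → mul c = one (tgt (pr₁ c))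
  mul_assoc : ∀ a b c d, pr₂ a = pr₁ b → pr₁ c = mul a → pr₂ c = pr₂ b →
    pr₁ d = pr₁ a → pr₂ d = mul b → mul c = mul d

namespace GroupoidMaps

/-- The graph of the multiplication of the tangent groupoid `TG ⇉ TM`: the composable pairs of `TG`
are the pairs `(d pr₁ ξ, d pr₂ ξ)`, with `ξ` a tangent vector to the manifold of composable pairs,
and their product is `dm ξ`. -/
def TangentMul (IG : ModelWithCorners ℝ EG HG) (IP : ModelWithCorners ℝ EP HP)
    (𝒢 : GroupoidMaps M G P) (V W U : TangentBundle IG G) : Prop :=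
  ∃ ξ : TangentBundle IP P, tangentMap IP IG 𝒢.pr₁ ξ = V ∧ tangentMap IP IG 𝒢.pr₂ ξ = W ∧
    tangentMap IP IG 𝒢.mul ξ = U

/-- The fiber `A_x = ker (ds)` over the unit at `x` of the Lie algebroid of `G ⇉ M`. -/
def Alg (IM : ModelWithCorners ℝ EM HM) (IG : ModelWithCorners ℝ EG HG)
    (𝒢 : GroupoidMaps M G P) (x : M) : Submodule ℝ (TangentSpace IG (𝒢.one x)) :=
  LinearMap.ker (mfderiv IG IM 𝒢.src (𝒢.one x)).toLinearMap

/-- Covectors `η` at `g` and `θ` at `h`, where `c = (g, h)`, are composable in the cotangent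
groupoid `T*G ⇉ A*`, i.e. `s(η) = t(θ)` in `A*_x`, `x = s(g) = t(h)`, where
`⟨s(η), a⟩ = - ⟨η, 0_g · a⁻¹⟩` and `⟨t(θ), a⟩ = ⟨θ, a · 0_h⟩`, the products being those in `TG`. -/
def CotangentComposable (IM : ModelWithCorners ℝ EM HM) (IG : ModelWithCorners ℝ EG HG)
    (IP : ModelWithCorners ℝ EP HP) (𝒢 : GroupoidMaps M G P) (c : P)
    (η : TangentSpace IG (𝒢.pr₁ c) →L[ℝ] ℝ) (θ : TangentSpace IG (𝒢.pr₂ c) →L[ℝ] ℝ) : Prop :=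
  ∀ a ∈ 𝒢.Alg IM IG (𝒢.src (𝒢.pr₁ c)),
    ∀ (u : TangentSpace IG (𝒢.pr₁ c)) (w : TangentSpace IG (𝒢.pr₂ c)),
      𝒢.TangentMul IG IP ⟨𝒢.pr₁ c, 0⟩ (tangentMap IG IG 𝒢.inv ⟨_, a⟩) ⟨𝒢.pr₁ c, u⟩ →
      𝒢.TangentMul IG IP ⟨_, a⟩ ⟨𝒢.pr₂ c, 0⟩ ⟨𝒢.pr₂ c, w⟩ →
      - η u = θ w

/-- The graph of the multiplication of the cotangent groupoid: `κ = η · θ` iff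
`⟨κ, v · w⟩ = ⟨η, v⟩ + ⟨θ, w⟩` for all composable tangent vectors `v, w`. -/
def CotangentMul (IG : ModelWithCorners ℝ EG HG) (IP : ModelWithCorners ℝ EP HP)
    (𝒢 : GroupoidMaps M G P) (c : P) (η : TangentSpace IG (𝒢.pr₁ c) →L[ℝ] ℝ)
    (θ : TangentSpace IG (𝒢.pr₂ c) →L[ℝ] ℝ) (κ : TangentSpace IG (𝒢.mul c) →L[ℝ] ℝ) : Prop :=
  ∀ ξ : TangentSpace IP c, κ (mfderiv IP IG 𝒢.mul c ξ) =
    η (mfderiv IP IG 𝒢.pr₁ c ξ) + θ (mfderiv IP IG 𝒢.pr₂ c ξ)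

/-- An `(l, m)`-tensor `T` on `G` is multiplicative if `f_T(Θ₁ · Θ₂) = f_T(Θ₁) + f_T(Θ₂)` for all
composable arrows `Θ₁, Θ₂` of the groupoid `TG ×_G ⋯ ×_G TG ×_G T*G ×_G ⋯ ×_G T*G`
(`l` factors `TG`, `m` factors `T*G`). Here `Θ₁` and `Θ₂` are over the arrows `g` and `h`,
`c = (g, h)`, their tangent components are composable via the `ξ i`, their cotangent components are
`η` and `θ`, and the cotangent components of the product are `κ`. -/
def IsMultiplicativeTensor (IM : ModelWithCorners ℝ EM HM) (IG : ModelWithCorners ℝ EG HG)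
    (IP : ModelWithCorners ℝ EP HP) (𝒢 : GroupoidMaps M G P) {l m : ℕ}
    (T : ∀ g : G, TensorFib IG l m g) : Prop :=
  ∀ (c : P) (ξ : Fin l → TangentSpace IP c)
    (η : Fin m → (TangentSpace IG (𝒢.pr₁ c) →L[ℝ] ℝ))
    (θ : Fin m → (TangentSpace IG (𝒢.pr₂ c) →L[ℝ] ℝ))
    (κ : Fin m → (TangentSpace IG (𝒢.mul c) →L[ℝ] ℝ)),
    (∀ j, 𝒢.CotangentComposable IM IG IP c (η j) (θ j)) →
    (∀ j, 𝒢.CotangentMul IG IP c (η j) (θ j) (κ j)) →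
    T (𝒢.mul c) (fun i => mfderiv IP IG 𝒢.mul c (ξ i)) κ =
      T (𝒢.pr₁ c) (fun i => mfderiv IP IG 𝒢.pr₁ c (ξ i)) η +
      T (𝒢.pr₂ c) (fun i => mfderiv IP IG 𝒢.pr₂ c (ξ i)) θ

end GroupoidMaps

namespace LieGroupoid

/-- The underlying structure maps of a Lie groupoid. -/
def maps (𝒢 : LieGroupoid IM M IG G IP P) : GroupoidMaps M G P :=
  ⟨𝒢.src, 𝒢.tgt, 𝒢.pr₁, 𝒢.pr₂, 𝒢.mul, 𝒢.one, 𝒢.inv⟩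

/-! ### LB-groupoids -/

/-- A smooth linear action of a Lie groupoid `G ⇉ M` on a line bundle `L → M`. Such an action is
the same as an LB-groupoid `(t^*L ⇉ 0_M; G ⇉ M)`, with multiplication
`(g, ℓ) · (h, ℓ') = (gh, ℓ + g.ℓ')`. -/
structure LineAction (𝒢 : LieGroupoid IM M IG G IP P) (L : LineBundle IM M) where
  /-- the action `ℓ ↦ g.ℓ` -/
  act : ∀ g, L.Fib (𝒢.src g) ≃L[ℝ] L.Fib (𝒢.tgt g)
  smooth : ContMDiff (IG.prod 𝓘(ℝ, ℝ)) (IM.prod 𝓘(ℝ, ℝ)) ∞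
    (fun v : (L.pullback 𝒢.src).Tot => (⟨𝒢.tgt v.1, act v.1 v.2⟩ : L.Tot))
  act_one : ∀ x (ℓ : L.Fib (𝒢.src (𝒢.one x))),
    (⟨𝒢.tgt (𝒢.one x), act (𝒢.one x) ℓ⟩ : L.Tot) = ⟨𝒢.src (𝒢.one x), ℓ⟩
  act_mul : ∀ c (ℓ : L.Fib (𝒢.src (𝒢.pr₂ c))),
    (⟨𝒢.tgt (𝒢.mul c), act (𝒢.mul c) (L.castFib (𝒢.src_mul c).symm ℓ)⟩ : L.Tot) =
      ⟨𝒢.tgt (𝒢.pr₁ c), act (𝒢.pr₁ c) (L.castFib (𝒢.src_pr₁ c).symm (act (𝒢.pr₂ c) ℓ))⟩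

end LieGroupoid

theorem LineBundle.contMDiff_lift {L : LineBundle IM M} (f : C^∞⟮IG, G; IM, M⟯) :
    ContMDiff (IG.prod 𝓘(ℝ, ℝ)) (IM.prod 𝓘(ℝ, ℝ)) ∞
      (fun v : (L.pullback f).Tot => (⟨f v.1, v.2⟩ : L.Tot)) := by
  intro v
  rw [contMDiffAt_totalSpace]
  have h := contMDiffAt_totalSpace.1
    (contMDiffAt_id (I := IG.prod 𝓘(ℝ, ℝ)) (n := ∞) (x := v))
  exact ⟨f.contMDiff.contMDiffAt.comp v h.1, h.2⟩

theorem LineBundle.contMDiff_pullback {L : LineBundle IM M} {f : C^∞⟮IG, G; IM, M⟯}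
    {Φ : P → (L.pullback f).Tot} (h₁ : ContMDiff IP IG ∞ (fun p => (Φ p).1))
    (h₂ : ContMDiff IP (IM.prod 𝓘(ℝ, ℝ)) ∞ (fun p => (⟨f (Φ p).1, (Φ p).2⟩ : L.Tot))) :
    ContMDiff IP (IG.prod 𝓘(ℝ, ℝ)) ∞ Φ := by
  intro p
  rw [contMDiffAt_totalSpace]
  exact ⟨h₁ p, (contMDiffAt_totalSpace.1 (h₂ p)).2⟩

namespace LieGroupoid

variable (𝒢 : LieGroupoid IM M IG G IP P) {L : LineBundle IM M}

/-- The line bundle `L_G = t^*L` over `G`. -/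
abbrev LG (L : LineBundle IM M) : LineBundle IG G := L.pullback 𝒢.tgt

/-- The line bundle `m^*L_G` over the manifold of composable pairs. -/
abbrev LP (L : LineBundle IM M) : LineBundle IP P := (𝒢.LG L).pullback 𝒢.mul

/-- The line bundle map `L_G → L` over the target. -/
def tL (L : LineBundle IM M) : LineBundleMap (𝒢.LG L) L where
  base := 𝒢.tgt
  fib g := ContinuousLinearEquiv.refl ℝ (L.Fib (𝒢.tgt g))
  smooth := LineBundle.contMDiff_lift 𝒢.tgt

/-- The line bundle map `m^*L_G → L_G` over the multiplication. -/
def mL (L : LineBundle IM M) : LineBundleMap (𝒢.LP L) (𝒢.LG L) where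
  base := 𝒢.mul
  fib c := ContinuousLinearEquiv.refl ℝ ((𝒢.LG L).Fib (𝒢.mul c))
  smooth := LineBundle.contMDiff_lift 𝒢.mul

/-- The line bundle map `m^*L_G ≅ pr₁^*L_G → L_G` over the first projection, where `m^*L_G` and
`pr₁^*L_G` are identified using `t ∘ m = t ∘ pr₁`. -/
def p₁L (L : LineBundle IM M) : LineBundleMap (𝒢.LP L) (𝒢.LG L) where
  base := 𝒢.pr₁
  fib c := (L.castFib (𝒢.tgt_mul c) : L.Fib (𝒢.tgt (𝒢.mul c)) ≃L[ℝ] L.Fib (𝒢.tgt (𝒢.pr₁ c)))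
  smooth := by
    apply LineBundle.contMDiff_pullback
    · exact 𝒢.pr₁.contMDiff.comp (contMDiff_proj _)
    · refine ((LineBundle.contMDiff_lift 𝒢.tgt).comp
        (LineBundle.contMDiff_lift (L := 𝒢.LG L) 𝒢.mul)).congr fun v => ?_
      exact L.mk_castFib (𝒢.tgt_mul v.1) v.2

/-- The line bundle map `L → L_G` over the unit map, `ℓ ↦ (1, ℓ)`. -/
def oneL (L : LineBundle IM M) : LineBundleMap L (𝒢.LG L) where
  base := 𝒢.one
  fib x := (L.castFib (𝒢.tgt_one x).symm : L.Fib x ≃L[ℝ] L.Fib (𝒢.tgt (𝒢.one x)))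
  smooth := by
    apply LineBundle.contMDiff_pullback
    · exact 𝒢.one.contMDiff.comp (contMDiff_proj _)
    · exact contMDiff_id.congr fun v => L.mk_castFib (𝒢.tgt_one v.1).symm v.2

namespace LineAction

variable {𝒢} (ρ : LineAction 𝒢 L)

theorem mk_act {g g' : G} (h : g = g') (ℓ : L.Fib (𝒢.src g)) :
    (⟨𝒢.tgt g, ρ.act g ℓ⟩ : L.Tot) =
      ⟨𝒢.tgt g', ρ.act g' (L.castFib (congrArg 𝒢.src h) ℓ)⟩ := by
  subst h; rfl

theorem act_inv (g : G) (ℓ : L.Fib (𝒢.tgt g)) :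
    (⟨𝒢.tgt (𝒢.inv g), ρ.act (𝒢.inv g) (L.castFib (𝒢.src_inv g).symm ℓ)⟩ : L.Tot) =
      ⟨𝒢.src g, (ρ.act g).symm ℓ⟩ := by
  obtain ⟨c, h₁, h₂⟩ := 𝒢.exists_pair (𝒢.inv g) g (𝒢.src_inv g)
  have hm : 𝒢.mul c = 𝒢.one (𝒢.src g) := by rw [𝒢.inv_mul c (by rw [h₁, h₂]), h₂]
  have e₀ : 𝒢.src g = 𝒢.src (𝒢.pr₂ c) := by rw [h₂]
  set ℓ₀ := (ρ.act g).symm ℓ with hℓ₀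
  have hact : (⟨𝒢.tgt (𝒢.pr₂ c), ρ.act (𝒢.pr₂ c) (L.castFib e₀ ℓ₀)⟩ : L.Tot) = ⟨𝒢.tgt g, ℓ⟩ := by
    have h : L.castFib (congrArg 𝒢.src h₂) (L.castFib e₀ ℓ₀) = ℓ₀ :=
      TotalSpace.mk_inj.1 ((L.mk_castFib _ _).trans (L.mk_castFib _ _))
    rw [ρ.mk_act h₂, h, hℓ₀, ContinuousLinearEquiv.apply_symm_apply]
  have key := ρ.act_mul c (L.castFib e₀ ℓ₀)
  rw [ρ.mk_act hm, ρ.act_one, L.mk_castFib, L.mk_castFib, L.mk_castFib, ρ.mk_act h₁] at key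
  rw [key]
  have h : L.castFib (congrArg 𝒢.src h₁)
      (L.castFib (𝒢.src_pr₁ c).symm (ρ.act (𝒢.pr₂ c) (L.castFib e₀ ℓ₀))) =
        L.castFib (𝒢.src_inv g).symm ℓ :=
    TotalSpace.mk_inj.1 (((L.mk_castFib _ _).trans (L.mk_castFib _ _)).trans
      (hact.trans (L.mk_castFib _ _).symm))
  rw [h]

theorem contMDiff_act_symm : ContMDiff (IG.prod 𝓘(ℝ, ℝ)) (IM.prod 𝓘(ℝ, ℝ)) ∞
    (fun v : (𝒢.LG L).Tot => (⟨𝒢.src v.1, (ρ.act v.1).symm v.2⟩ : L.Tot)) := by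
  have h : ContMDiff (IG.prod 𝓘(ℝ, ℝ)) (IG.prod 𝓘(ℝ, ℝ)) ∞
      (fun v : (𝒢.LG L).Tot => (⟨𝒢.inv v.1, L.castFib (𝒢.src_inv v.1).symm v.2⟩ :
        (L.pullback 𝒢.src).Tot)) := by
    apply LineBundle.contMDiff_pullback
    · exact 𝒢.inv.contMDiff.comp (contMDiff_proj _)
    · exact (LineBundle.contMDiff_lift 𝒢.tgt).congr fun v =>
        L.mk_castFib (𝒢.src_inv v.1).symm v.2
  exact (ρ.smooth.comp h).congr fun v => (ρ.act_inv v.1 v.2).symm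

/-- The line bundle map `L_G → L` over the source, `(g, ℓ) ↦ g⁻¹.ℓ`, i.e. the composition
`s_L ∘ τ⁻¹` of the canonical map `s_L : s^*L → L` and the inverse of the isomorphism
`τ : s^*L → t^*L`, `(g, ℓ) ↦ (g, g.ℓ)`. -/
def sL : LineBundleMap (𝒢.LG L) L where
  base := 𝒢.src
  fib g := ((ρ.act g).symm : L.Fib (𝒢.tgt g) ≃L[ℝ] L.Fib (𝒢.src g))
  smooth := ρ.contMDiff_act_symm

/-- The line bundle map `m^*L_G → L_G` over the second projection, `((g, h), ℓ) ↦ (h, g⁻¹.ℓ)`. -/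
def p₂L : LineBundleMap (𝒢.LP L) (𝒢.LG L) where
  base := 𝒢.pr₂
  fib c := (((L.castFib (𝒢.tgt_mul c)).trans (ρ.act (𝒢.pr₁ c)).symm).trans
    (L.castFib (𝒢.src_pr₁ c)) : L.Fib (𝒢.tgt (𝒢.mul c)) ≃L[ℝ] L.Fib (𝒢.tgt (𝒢.pr₂ c)))
  smooth := by
    apply LineBundle.contMDiff_pullback
    · exact 𝒢.pr₂.contMDiff.comp (contMDiff_proj _)
    · exact (ρ.contMDiff_act_symm.comp (𝒢.p₁L L).smooth).congr fun v =>
        L.mk_castFib (𝒢.src_pr₁ v.1) _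

/-- The line bundle map `L_G → L_G` over the inversion, `(g, ℓ) ↦ (g⁻¹, g⁻¹.ℓ)`. -/
def iL : LineBundleMap (𝒢.LG L) (𝒢.LG L) where
  base := 𝒢.inv
  fib g := ((ρ.act g).symm.trans (L.castFib (𝒢.tgt_inv g).symm) :
    L.Fib (𝒢.tgt g) ≃L[ℝ] L.Fib (𝒢.tgt (𝒢.inv g)))
  smooth := by
    apply LineBundle.contMDiff_pullback
    · exact 𝒢.inv.contMDiff.comp (contMDiff_proj _)
    · exact ρ.contMDiff_act_symm.congr fun v => L.mk_castFib (𝒢.tgt_inv v.1).symm _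

/-- The homogenization `G̃ ⇉ M̃` of an LB-groupoid, obtained from the dual VB-groupoid by removing
the zero section. An arrow of `G̃` is a pair `(g, ε)` with `ε` a nonzero linear form on
`L_{t(g)} ≅ L_{s(g)}`; source and target are `(g, ε) ↦ g⁻¹.ε` and `(g, ε) ↦ ε`, and
`(g, ε) · (h, δ) = (gh, ε)` when `δ = g⁻¹.ε`. -/
def hgz : GroupoidMaps L.Hgz (𝒢.LG L).Hgz (𝒢.LP L).Hgz where
  src := ρ.sL.hgz
  tgt := (𝒢.tL L).hgz
  pr₁ := (𝒢.p₁L L).hgz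
  pr₂ := ρ.p₂L.hgz
  mul := (𝒢.mL L).hgz
  one := (𝒢.oneL L).hgz
  inv := ρ.iL.hgz

/-- The multiplication of the LB-groupoid `L_G`: `(g, ℓ) · (h, ℓ') = (gh, ℓ + g.ℓ')`. -/
def mulLG (c : P) (ℓ : (𝒢.LG L).Fib (𝒢.pr₁ c)) (ℓ' : (𝒢.LG L).Fib (𝒢.pr₂ c)) :
    (𝒢.LG L).Fib (𝒢.mul c) :=
  L.castFib (𝒢.tgt_mul c).symm
    ((show L.Fib (𝒢.tgt (𝒢.pr₁ c)) from ℓ) + ρ.act (𝒢.pr₁ c) (L.castFib (𝒢.src_pr₁ c).symm ℓ'))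

variable [IsManifold IM ∞ M] [IsManifold IG ∞ G] [IsManifold IP ∞ P]

/-- The graph of the multiplication of the groupoid `DL_G ⇉ DL`. The manifold of composable pairs
is identified with `D(m^*L_G)` by mapping `□` to the pair with components the images of `□` under
`D(pr₁)` and `D(pr₂)`, and the product of the pair corresponding to `□` is `Dm(□)`. -/
def DMul (Δ₁ Δ₂ Δ₃ : Σ g, (𝒢.LG L).D g) : Prop :=
  ∃ B : Σ c, (𝒢.LP L).D c,
    (𝒢.p₁L L).DTot B = Δ₁ ∧ ρ.p₂L.DTot B = Δ₂ ∧ (𝒢.mL L).DTot B = Δ₃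

/-- The core of `DL_G ⇉ DL` over `x`: the derivations at the unit at `x` in the kernel of the source
map `s_D`. The symbol identifies it with the fiber `A_x` of the Lie algebroid of `G ⇉ M`; the
derivation corresponding to `a` is `𝔻_a`. -/
def core (x : M) : Submodule ℝ ((𝒢.LG L).D (𝒢.one x)) := LinearMap.ker (ρ.sL.D (𝒢.one x))

/-- Jets `ψ₁` at `g` and `ψ₂` at `h`, where `c = (g, h)`, are composable in the groupoid
`J¹L_G ⇉ A* ⊗ L`, i.e. `s(ψ₁) = t(ψ₂)` in `Hom(A_x, L_x)`, `x = s(g) = t(h)`, where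
`⟨s(ψ₁), a⟩ = - g⁻¹.⟨ψ₁, 0_g · 𝔻_a⁻¹⟩` and `⟨t(ψ₂), a⟩ = ⟨ψ₂, 𝔻_a · 0_h⟩`, the products being those
in `DL_G`. -/
def JetComposable (c : P) (ψ₁ : (𝒢.LG L).J (𝒢.pr₁ c)) (ψ₂ : (𝒢.LG L).J (𝒢.pr₂ c)) : Prop :=
  ∀ a ∈ ρ.core (𝒢.src (𝒢.pr₁ c)),
    ∀ (u : (𝒢.LG L).D (𝒢.pr₁ c)) (w : (𝒢.LG L).D (𝒢.pr₂ c)),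
      ρ.DMul ⟨𝒢.pr₁ c, 0⟩ (ρ.iL.DTot ⟨_, a⟩) ⟨𝒢.pr₁ c, u⟩ →
      ρ.DMul ⟨_, a⟩ ⟨𝒢.pr₂ c, 0⟩ ⟨𝒢.pr₂ c, w⟩ →
      L.castFib (𝒢.src_pr₁ c) (- (ρ.act (𝒢.pr₁ c)).symm (ψ₁ u)) = ψ₂ w

/-- The graph of the multiplication of the groupoid `J¹L_G`: `χ = ψ₁ · ψ₂` iff
`⟨χ, Δ₁ · Δ₂⟩ = ⟨ψ₁, Δ₁⟩ · ⟨ψ₂, Δ₂⟩` (product in `L_G`) for all composable `Δ₁, Δ₂` in `DL_G`. -/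
def JetMul (c : P) (ψ₁ : (𝒢.LG L).J (𝒢.pr₁ c)) (ψ₂ : (𝒢.LG L).J (𝒢.pr₂ c))
    (χ : (𝒢.LG L).J (𝒢.mul c)) : Prop :=
  ∀ B : (𝒢.LP L).D c, χ ((𝒢.mL L).D c B) =
    ρ.mulLG c (ψ₁ ((𝒢.p₁L L).D c B)) (ψ₂ (ρ.p₂L.D c B))

/-- An Atiyah `(l, m)`-tensor `T` on `L_G` is multiplicative if
`f_T : DL_G ×_G ⋯ ×_G DL_G ×_G J¹L_G ×_G ⋯ ×_G J¹L_G → L_G` (`l` factors `DL_G`, `m` factors `J¹L_G`)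
is a groupoid map: `f_T(Θ₁ · Θ₂) = f_T(Θ₁) · f_T(Θ₂)` for all composable `Θ₁, Θ₂`. Here `Θ₁` and `Θ₂`
are over the arrows `g` and `h`, `c = (g, h)`, their components in `DL_G` are composable via the
`B i`, their jet components are `ψ₁` and `ψ₂`, and the jet components of the product are `χ`. -/
def IsMultiplicative {l m : ℕ} (T : (𝒢.LG L).AtiyahTensor l m) : Prop :=
  ∀ (c : P) (B : Fin l → (𝒢.LP L).D c) (ψ₁ : Fin m → (𝒢.LG L).J (𝒢.pr₁ c))
    (ψ₂ : Fin m → (𝒢.LG L).J (𝒢.pr₂ c)) (χ : Fin m → (𝒢.LG L).J (𝒢.mul c)),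
    (∀ j, ρ.JetComposable c (ψ₁ j) (ψ₂ j)) →
    (∀ j, ρ.JetMul c (ψ₁ j) (ψ₂ j) (χ j)) →
    T.toFun (𝒢.mul c) (fun i => (𝒢.mL L).D c (B i)) χ =
      ρ.mulLG c (T.toFun (𝒢.pr₁ c) (fun i => (𝒢.p₁L L).D c (B i)) ψ₁)
        (T.toFun (𝒢.pr₂ c) (fun i => ρ.p₂L.D c (B i)) ψ₂)

end LineAction
end LieGroupoid
end Groupoids
end

/-!
Homogenization is functorial: a line bundle map `φ : L_N → L` which is an isomorphism on fibers
induces a smooth map `φ̃ : Ñ → M̃`, bijective from the fiber over `y` onto the fiber over `φ(y)`.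
The fiberwise bijections `p_T` and `p_{T*}` are natural: `p_T ∘ dφ̃ = Dφ ∘ p_T`, and
`p_{T*}` is dual to `p_T`. Naturality reduces to `(φ^*λ)~ = λ̃ ∘ φ̃` for sections `λ` of `L`.
The structure maps of `DL_G` are `Dφ`, and those of the groupoid `G̃` are `φ̃`, for the same line
bundle maps `φ`, and a nonzero form `ε` turns the product of `L_G` into addition in `ℝ`. Hence
every condition over a pair `(g, h)` translates, via `p_T`, `p_{T*}` and pairing with `ε`, into the
corresponding condition at any point of the homogenization above `(g, h)`.
-/

local notation "𝓘ₕ(" I ")" => ModelWithCorners.prod I 𝓘(ℝ, ℝ →L[ℝ] ℝ)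

namespace LineBundle

variable {E : Type*} [NormedAddCommGroup E] [NormedSpace ℝ E]
  {H : Type*} [TopologicalSpace H] {I : ModelWithCorners ℝ E H}
  {M : Type*} [TopologicalSpace M] [ChartedSpace H M]
  {E' : Type*} [NormedAddCommGroup E'] [NormedSpace ℝ E']
  {H' : Type*} [TopologicalSpace H'] {I' : ModelWithCorners ℝ E' H'}
  {N : Type*} [TopologicalSpace N] [ChartedSpace H' N]
  (L : LineBundle I M)

theorem castFib_symm {x y : M} (h : x = y) : (L.castFib h).symm = L.castFib h.symm := by
  subst h; rfl

theorem hproj_surjective : Function.Surjective L.hproj := by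
  intro x
  let A := (trivializationAt ℝ L.Fib x).continuousLinearEquivAt ℝ x
    (FiberBundle.mem_baseSet_trivializationAt' x)
  refine ⟨⟨⟨x, (A : L.Fib x →L[ℝ] ℝ)⟩, fun h => ?_⟩, rfl⟩
  have : A (A.symm 1) = 0 := congrArg (fun f => f (A.symm 1)) h
  exact one_ne_zero ((A.apply_symm_apply 1).symm.trans this)

/-- The vector bundle map `p_T : TM̃ → DL` on total spaces. -/
noncomputable def pTTot (V : TangentBundle 𝓘ₕ(I) L.Hgz) : Σ x, L.D x :=
  ⟨L.hproj V.proj, L.pT V.proj V.2⟩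

theorem pTTot_zero (ε : L.Hgz) : L.pTTot ⟨ε, 0⟩ = ⟨L.hproj ε, 0⟩ :=
  congrArg (Sigma.mk (β := fun x => L.D x) _) (map_zero (L.pT ε))

variable [FiniteDimensional ℝ E] [IsManifold I ∞ M] [T2Space M]

theorem pTTot_injOn_fiber {V W : TangentBundle 𝓘ₕ(I) L.Hgz} (hp : V.proj = W.proj)
    (h : L.pTTot V = L.pTTot W) : V = W := by
  obtain ⟨ε, v⟩ := V
  obtain ⟨δ, w⟩ := W
  obtain rfl : ε = δ := hp
  exact congrArg (TotalSpace.mk ε) ((L.pT_bijective ε).1 (eq_of_heq (Sigma.mk.inj h).2))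

theorem pTstar_surjective (ε : L.Hgz) : Function.Surjective (L.pTstar ε) := by
  intro ψ
  have : FiniteDimensional ℝ (L.HT ε) :=
    inferInstanceAs (FiniteDimensional ℝ (E × (ℝ →L[ℝ] ℝ)))
  have : T2Space (L.HT ε) := inferInstanceAs (T2Space (E × (ℝ →L[ℝ] ℝ)))
  have : IsTopologicalAddGroup (L.HT ε) :=
    inferInstanceAs (IsTopologicalAddGroup (E × (ℝ →L[ℝ] ℝ)))
  have : ContinuousSMul ℝ (L.HT ε) :=
    inferInstanceAs (ContinuousSMul ℝ (E × (ℝ →L[ℝ] ℝ)))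
  refine ⟨LinearMap.toContinuousLinearMap
    ((L.form ε : L.Fib (L.hproj ε) →ₗ[ℝ] ℝ) ∘ₗ ψ ∘ₗ L.pT ε), LinearMap.ext fun Δ => ?_⟩
  obtain ⟨v, rfl⟩ := (L.pT_bijective ε).2 Δ
  exact (L.bijective_form ε).1 (L.form_pTstar_pT ε _ v)

variable {L}

theorem contMDiffAt_of_hproj_hsec {f : N → L.Hgz} {y : N}
    (hbase : ContMDiffAt I' I ∞ (fun z => L.hproj (f z)) y)
    (hsec : ∀ lam : L.Sec, ContMDiffAt I' 𝓘(ℝ, ℝ) ∞ (fun z => L.hsec lam (f z)) y) :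
    ContMDiffAt I' 𝓘ₕ(I) ∞ f y := by
  rw [← ContMDiffAt.subtypeVal_comp_iff]
  obtain ⟨s, -, -, hs, -⟩ := L.exists_frame (L.hproj (f y))
  let e := trivializationAt ℝ L.Fib (L.hproj (f y))
  have hcoord : ContMDiffAt I' 𝓘(ℝ, ℝ →L[ℝ] ℝ) ∞ (fun z =>
      ContinuousLinearMap.toSpanSingleton ℝ (ContinuousLinearMap.id ℝ ℝ) (L.hsec s (f z))) y :=
    (ContinuousLinearMap.contMDiff _).contMDiffAt.comp y (hsec s)
  refine (contMDiffAt_hom_bundle (E₁ := L.Fib) (E₂ := Trivial M ℝ) _).2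
    ⟨hbase, hcoord.congr_of_eventuallyEq ?_⟩
  filter_upwards [hbase.continuousAt.eventually hs, hbase.continuousAt.preimage_mem_nhds
    (e.open_baseSet.mem_nhds (FiberBundle.mem_baseSet_trivializationAt' _))] with z hz hze
  have hframe : e.symmL ℝ (L.hproj (f z)) 1 = s (L.hproj (f z)) := by
    rw [Bundle.Trivialization.symmL_apply _ hze, hz]
  have hform : L.form (f z) (e.symmL ℝ (L.hproj (f z)) 1) = L.hsec s (f z) :=
    congrArg (L.form (f z)) hframe
  ext
  refine Eq.trans ?_ (hform.trans (mul_one _).symm)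
  change (trivializationAt ℝ (Trivial M ℝ) _).continuousLinearMapAt ℝ _ (L.form (f z) _) = _
  simp only [Trivial.fiberBundle_trivializationAt', Trivial.continuousLinearMapAt_trivialization,
    ContinuousLinearMap.id_apply]
  rfl

end LineBundle

namespace LineBundleMap

variable {E : Type*} [NormedAddCommGroup E] [NormedSpace ℝ E]
  {H : Type*} [TopologicalSpace H] {I : ModelWithCorners ℝ E H}
  {M : Type*} [TopologicalSpace M] [ChartedSpace H M] {L : LineBundle I M}
  {E' : Type*} [NormedAddCommGroup E'] [NormedSpace ℝ E']
  {H' : Type*} [TopologicalSpace H'] {I' : ModelWithCorners ℝ E' H'}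
  {N : Type*} [TopologicalSpace N] [ChartedSpace H' N] {LN : LineBundle I' N}

section

variable {E'' : Type*} [NormedAddCommGroup E''] [NormedSpace ℝ E'']
  {H'' : Type*} [TopologicalSpace H''] {I'' : ModelWithCorners ℝ E'' H''}
  {Q : Type*} [TopologicalSpace Q] [ChartedSpace H'' Q] {LQ : LineBundle I'' Q}

/-- The identity of a line bundle, as a line bundle map. -/
protected noncomputable def id (L : LineBundle I M) : LineBundleMap L L where
  base := ContMDiffMap.id
  fib x := ContinuousLinearEquiv.refl ℝ (L.Fib x)
  smooth := contMDiff_id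

/-- The composition of line bundle maps. -/
noncomputable def comp (ψ : LineBundleMap LN L) (φ : LineBundleMap LQ LN) : LineBundleMap LQ L where
  base := ψ.base.comp φ.base
  fib y := (φ.fib y).trans (ψ.fib (φ.base y))
  smooth := ψ.smooth.comp φ.smooth

theorem ext_of_tot {φ ψ : LineBundleMap LN L}
    (h : ∀ y (v : LN.Fib y), (⟨φ.base y, φ.fib y v⟩ : L.Tot) = ⟨ψ.base y, ψ.fib y v⟩) :
    φ = ψ := by
  obtain ⟨f, A, hA⟩ := φ
  obtain ⟨g, B, hB⟩ := ψ
  obtain rfl : f = g := ContMDiffMap.ext fun y => congrArg TotalSpace.proj (h y 0)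
  obtain rfl : A = B := funext fun y => ContinuousLinearEquiv.ext <| funext fun v =>
    TotalSpace.mk_inj.1 (h y v)
  rfl

end

theorem form_hgz_fib (φ : LineBundleMap LN L) (ε : LN.Hgz) (v : LN.Fib (LN.hproj ε)) :
    L.form (φ.hgz ε) (φ.fib (LN.hproj ε) v) = LN.form ε v :=
  congrArg (LN.form ε) ((φ.fib (LN.hproj ε)).symm_apply_apply v)

theorem pL_hgz (φ : LineBundleMap LN L) (ε : LN.Hgz) (r : ℝ) :
    L.pL (φ.hgz ε) r = φ.fib (LN.hproj ε) (LN.pL ε r) := by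
  apply (L.bijective_form (φ.hgz ε)).1
  rw [L.form_pL]
  exact ((φ.form_hgz_fib ε _).trans (LN.form_pL ε r)).symm

theorem hgz_injOn_fiber (φ : LineBundleMap LN L) {ε δ : LN.Hgz} (h : LN.hproj ε = LN.hproj δ)
    (hφ : φ.hgz ε = φ.hgz δ) : ε = δ := by
  obtain ⟨⟨x, f⟩, hf⟩ := ε
  obtain ⟨⟨y, f'⟩, hf'⟩ := δ
  obtain rfl : x = y := h
  have hforms := DFunLike.congr_fun (TotalSpace.mk_inj.1 (Subtype.mk.inj hφ))
  obtain rfl : f = f' := ContinuousLinearMap.ext fun v =>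
    (φ.form_hgz_fib ⟨⟨x, f⟩, hf⟩ v).symm.trans
      ((hforms (φ.fib x v)).trans (φ.form_hgz_fib ⟨⟨x, f'⟩, hf'⟩ v))
  rfl

theorem exists_hproj_eq_hgz_eq (φ : LineBundleMap LN L) {y : N} {ε : L.Hgz}
    (h : φ.base y = L.hproj ε) : ∃ δ : LN.Hgz, LN.hproj δ = y ∧ φ.hgz δ = ε := by
  obtain ⟨⟨x, f⟩, hf⟩ := ε
  obtain rfl : φ.base y = x := h
  refine ⟨⟨⟨y, ContinuousLinearMap.comp f (φ.fib y : LN.Fib y →L[ℝ] L.Fib (φ.base y))⟩,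
    fun h => hf (ContinuousLinearMap.ext fun v => ?_)⟩, rfl, ?_⟩
  · simpa using DFunLike.congr_fun h ((φ.fib y).symm v)
  · refine Subtype.ext (congrArg (TotalSpace.mk (φ.base y)) (ContinuousLinearMap.ext fun v => ?_))
    exact congrArg f ((φ.fib y).apply_symm_apply v)

/-- The tangent map `dφ̃ : TÑ → TM̃` of the homogenization of a line bundle map, at a point. -/
noncomputable abbrev dhgz (φ : LineBundleMap LN L) (ε : LN.Hgz) : LN.HT ε →L[ℝ] L.HT (φ.hgz ε) :=
  mfderiv 𝓘ₕ(I') 𝓘ₕ(I) φ.hgz ε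

variable [IsManifold I' ∞ N] [FiniteDimensional ℝ E] [IsManifold I ∞ M] [T2Space M]

theorem contMDiff_hgz (φ : LineBundleMap LN L) : ContMDiff 𝓘ₕ(I') 𝓘ₕ(I) ∞ φ.hgz := fun _ =>
  LineBundle.contMDiffAt_of_hproj_hsec
    (φ.base.contMDiff.comp LN.contMDiff_hproj).contMDiffAt
    fun lam => (LN.contMDiff_hsec (φ.pullSec lam)).contMDiffAt

theorem pT_dhgz (φ : LineBundleMap LN L) (ε : LN.Hgz) (v : LN.HT ε) :
    L.pT (φ.hgz ε) (φ.dhgz ε v) = φ.D (LN.hproj ε) (LN.pT ε v) := by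
  ext lam
  have hchain : mvfderiv 𝓘ₕ(I') (LN.hsec (φ.pullSec lam)) ε v =
      mvfderiv 𝓘ₕ(I) (L.hsec lam) (φ.hgz ε) (φ.dhgz ε v) :=
    mvfderiv_comp_apply ε (L.mdiff_hsec lam _) (φ.contMDiff_hgz.mdifferentiable (by simp) ε) v
  exact (congrArg (L.pL (φ.hgz ε)) hchain.symm).trans (φ.pL_hgz ε _)

theorem dTot_pTTot (φ : LineBundleMap LN L) (V : TangentBundle 𝓘ₕ(I') LN.Hgz) :
    φ.DTot (LN.pTTot V) = L.pTTot (tangentMap _ _ φ.hgz V) :=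
  congrArg (Sigma.mk (β := fun x => L.D x) (φ.base (LN.hproj V.proj)))
    (φ.pT_dhgz V.proj V.2).symm

theorem form_pTstar_D_pT (φ : LineBundleMap LN L) (ε : LN.Hgz) (v : LN.HT ε)
    (θ : L.HT (φ.hgz ε) →L[ℝ] ℝ) :
    L.form (φ.hgz ε) (L.pTstar (φ.hgz ε) θ (φ.D (LN.hproj ε) (LN.pT ε v))) =
      θ (φ.dhgz ε v) :=
  (congrArg (fun Δ => L.form (φ.hgz ε) (L.pTstar (φ.hgz ε) θ Δ)) (φ.pT_dhgz ε v).symm).trans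
    (L.form_pTstar_pT (φ.hgz ε) θ (φ.dhgz ε v))

theorem hgz_apply_dhgz (φ : LineBundleMap LN L) {l m : ℕ} (T : L.AtiyahTensor l m) (ε : LN.Hgz)
    (v : Fin l → LN.HT ε) (θ : Fin m → (L.HT (φ.hgz ε) →L[ℝ] ℝ)) :
    T.hgz (φ.hgz ε) (fun i => φ.dhgz ε (v i)) θ =
      L.form (φ.hgz ε) (T.toFun (φ.base (LN.hproj ε))
        (fun i => φ.D (LN.hproj ε) (LN.pT ε (v i))) fun j => L.pTstar (φ.hgz ε) (θ j)) :=
  congrArg (fun Δ => L.form (φ.hgz ε) (T.toFun (L.hproj (φ.hgz ε)) Δ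
    fun j => L.pTstar (φ.hgz ε) (θ j))) (funext fun i => φ.pT_dhgz ε (v i))

end LineBundleMap

namespace LieGroupoid

variable {EM : Type*} [NormedAddCommGroup EM] [NormedSpace ℝ EM]
  {HM : Type*} [TopologicalSpace HM] {IM : ModelWithCorners ℝ EM HM}
  {M : Type*} [TopologicalSpace M] [ChartedSpace HM M]
  {EG : Type*} [NormedAddCommGroup EG] [NormedSpace ℝ EG]
  {HG : Type*} [TopologicalSpace HG] {IG : ModelWithCorners ℝ EG HG}
  {G : Type*} [TopologicalSpace G] [ChartedSpace HG G]
  {EP : Type*} [NormedAddCommGroup EP] [NormedSpace ℝ EP]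
  {HP : Type*} [TopologicalSpace HP] {IP : ModelWithCorners ℝ EP HP}
  {P : Type*} [TopologicalSpace P] [ChartedSpace HP P]

theorem t2Space_pairs [T2Space G] (𝒢 : LieGroupoid IM M IG G IP P) : T2Space P :=
  𝒢.pair_embedding.isEmbedding.t2Space

variable (𝒢 : LieGroupoid IM M IG G IP P) (L : LineBundle IM M)

theorem tL_comp_mL : (𝒢.tL L).comp (𝒢.mL L) = (𝒢.tL L).comp (𝒢.p₁L L) :=
  LineBundleMap.ext_of_tot fun c ℓ => (L.mk_castFib (𝒢.tgt_mul c) ℓ).symm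

theorem tL_comp_oneL : (𝒢.tL L).comp (𝒢.oneL L) = LineBundleMap.id L :=
  LineBundleMap.ext_of_tot fun x ℓ => L.mk_castFib (𝒢.tgt_one x).symm ℓ

namespace LineAction

variable {𝒢 L} (ρ : LineAction 𝒢 L)

theorem sL_comp_p₁L : ρ.sL.comp (𝒢.p₁L L) = (𝒢.tL L).comp ρ.p₂L :=
  LineBundleMap.ext_of_tot fun c _ => (L.mk_castFib (𝒢.src_pr₁ c) _).symm

theorem sL_comp_oneL : ρ.sL.comp (𝒢.oneL L) = LineBundleMap.id L :=
  LineBundleMap.ext_of_tot fun x ℓ => by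
    let ℓ' := L.castFib (𝒢.tgt_one x).symm ℓ
    calc (⟨𝒢.src (𝒢.one x), (ρ.act (𝒢.one x)).symm ℓ'⟩ : L.Tot)
        = ⟨𝒢.tgt (𝒢.one x), ρ.act (𝒢.one x) ((ρ.act (𝒢.one x)).symm ℓ')⟩ :=
          (ρ.act_one x _).symm
      _ = ⟨𝒢.tgt (𝒢.one x), ℓ'⟩ := by rw [ContinuousLinearEquiv.apply_symm_apply]
      _ = ⟨x, ℓ⟩ := L.mk_castFib (𝒢.tgt_one x).symm ℓ

theorem tL_comp_iL : (𝒢.tL L).comp ρ.iL = ρ.sL :=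
  LineBundleMap.ext_of_tot fun g _ => L.mk_castFib (𝒢.tgt_inv g).symm _

theorem hgz_src_pr₁ (c : (𝒢.LP L).Hgz) : ρ.hgz.src (ρ.hgz.pr₁ c) = ρ.hgz.tgt (ρ.hgz.pr₂ c) :=
  congrArg (fun φ => φ.hgz c) ρ.sL_comp_p₁L

theorem hgz_tgt_mul (c : (𝒢.LP L).Hgz) : ρ.hgz.tgt (ρ.hgz.mul c) = ρ.hgz.tgt (ρ.hgz.pr₁ c) :=
  congrArg (fun φ => φ.hgz c) (𝒢.tL_comp_mL L)

theorem hgz_src_one (x : L.Hgz) : ρ.hgz.src (ρ.hgz.one x) = x :=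
  congrArg (fun φ => φ.hgz x) ρ.sL_comp_oneL

theorem hgz_tgt_one (x : L.Hgz) : ρ.hgz.tgt (ρ.hgz.one x) = x :=
  congrArg (fun φ => φ.hgz x) (𝒢.tL_comp_oneL L)

theorem hgz_tgt_inv (g : (𝒢.LG L).Hgz) : ρ.hgz.tgt (ρ.hgz.inv g) = ρ.hgz.src g :=
  congrArg (fun φ => φ.hgz g) ρ.tL_comp_iL

theorem mulLG_eq_add (c : P) (ℓ : (𝒢.LG L).Fib (𝒢.pr₁ c)) (ℓ' : (𝒢.LG L).Fib (𝒢.pr₂ c)) :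
    ρ.mulLG c ℓ ℓ' =
      (((𝒢.p₁L L).fib c).symm ℓ + (ρ.p₂L.fib c).symm ℓ' : (𝒢.LP L).Fib c) := by
  change L.castFib (𝒢.tgt_mul c).symm ((show L.Fib (𝒢.tgt (𝒢.pr₁ c)) from ℓ) +
    ρ.act (𝒢.pr₁ c) (L.castFib (𝒢.src_pr₁ c).symm ℓ')) =
    (L.castFib (𝒢.tgt_mul c)).symm ℓ + (L.castFib (𝒢.tgt_mul c)).symm
      (ρ.act (𝒢.pr₁ c) ((L.castFib (𝒢.src_pr₁ c)).symm ℓ'))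
  rw [LineBundle.castFib_symm, LineBundle.castFib_symm, map_add]

theorem form_mulLG (c : (𝒢.LP L).Hgz) (ℓ : (𝒢.LG L).Fib (𝒢.pr₁ ((𝒢.LP L).hproj c)))
    (ℓ' : (𝒢.LG L).Fib (𝒢.pr₂ ((𝒢.LP L).hproj c))) :
    (𝒢.LG L).form (ρ.hgz.mul c) (ρ.mulLG ((𝒢.LP L).hproj c) ℓ ℓ') =
      (𝒢.LG L).form (ρ.hgz.pr₁ c) ℓ + (𝒢.LG L).form (ρ.hgz.pr₂ c) ℓ' :=
  (congrArg ((𝒢.LP L).form c) (ρ.mulLG_eq_add _ ℓ ℓ')).trans (map_add ((𝒢.LP L).form c) _ _)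

theorem eq_mulLG_iff (c : (𝒢.LP L).Hgz) {ℓ : (𝒢.LG L).Fib (𝒢.pr₁ ((𝒢.LP L).hproj c))}
    {ℓ' : (𝒢.LG L).Fib (𝒢.pr₂ ((𝒢.LP L).hproj c))}
    {ℓ'' : (𝒢.LG L).Fib (𝒢.mul ((𝒢.LP L).hproj c))} :
    ℓ'' = ρ.mulLG ((𝒢.LP L).hproj c) ℓ ℓ' ↔
      (𝒢.LG L).form (ρ.hgz.mul c) ℓ'' =
        (𝒢.LG L).form (ρ.hgz.pr₁ c) ℓ + (𝒢.LG L).form (ρ.hgz.pr₂ c) ℓ' :=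
  ((𝒢.LG L).bijective_form (ρ.hgz.mul c)).1.eq_iff.symm.trans
    (Eq.congr_right (ρ.form_mulLG c ℓ ℓ'))

theorem castFib_neg_act_symm (c : P) (ℓ : (𝒢.LG L).Fib (𝒢.pr₁ c)) :
    L.castFib (𝒢.src_pr₁ c) (-(ρ.act (𝒢.pr₁ c)).symm ℓ) =
      ρ.p₂L.fib c (-((𝒢.p₁L L).fib c).symm ℓ) := by
  have hcancel : L.castFib (𝒢.tgt_mul c) ((L.castFib (𝒢.tgt_mul c)).symm ℓ) = ℓ :=
    (L.castFib (𝒢.tgt_mul c)).apply_symm_apply ℓ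
  rw [map_neg, map_neg]
  exact congrArg (fun z => -L.castFib (𝒢.src_pr₁ c) ((ρ.act (𝒢.pr₁ c)).symm z)) hcancel.symm

theorem form_castFib_neg_act_symm (c : (𝒢.LP L).Hgz)
    (ℓ : (𝒢.LG L).Fib (𝒢.pr₁ ((𝒢.LP L).hproj c))) :
    (𝒢.LG L).form (ρ.hgz.pr₂ c) (L.castFib (𝒢.src_pr₁ ((𝒢.LP L).hproj c))
      (-(ρ.act (𝒢.pr₁ ((𝒢.LP L).hproj c))).symm ℓ)) = -(𝒢.LG L).form (ρ.hgz.pr₁ c) ℓ :=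
  calc (𝒢.LG L).form (ρ.hgz.pr₂ c) _
    _ = (𝒢.LG L).form (ρ.p₂L.hgz c) (ρ.p₂L.fib _ (-((𝒢.p₁L L).fib _).symm ℓ)) :=
        congrArg ((𝒢.LG L).form (ρ.hgz.pr₂ c)) (ρ.castFib_neg_act_symm _ ℓ)
    _ = (𝒢.LP L).form c (-((𝒢.p₁L L).fib _).symm ℓ) := ρ.p₂L.form_hgz_fib c _
    _ = -(𝒢.LG L).form (ρ.hgz.pr₁ c) ℓ := map_neg ((𝒢.LP L).form c) _

variable [IsManifold IG ∞ G]

theorem pT_mem_core_iff [FiniteDimensional ℝ EM] [IsManifold IM ∞ M] [T2Space M] (x : L.Hgz)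
    (a : (𝒢.LG L).HT (ρ.hgz.one x)) :
    (𝒢.LG L).pT (ρ.hgz.one x) a ∈ ρ.core (L.hproj x) ↔ a ∈ ρ.hgz.Alg 𝓘ₕ(IM) 𝓘ₕ(IG) x :=
  (Eq.congr_left (ρ.sL.pT_dhgz (ρ.hgz.one x) a).symm).trans
    (map_eq_zero_iff _ (L.pT_bijective (ρ.hgz.src (ρ.hgz.one x))).1)

variable [FiniteDimensional ℝ EG] [T2Space G]

theorem castFib_neg_act_symm_pTstar_eq_iff (c : (𝒢.LP L).Hgz)
    (η : (𝒢.LG L).HT (ρ.hgz.pr₁ c) →L[ℝ] ℝ) (θ : (𝒢.LG L).HT (ρ.hgz.pr₂ c) →L[ℝ] ℝ)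
    (u : (𝒢.LG L).HT (ρ.hgz.pr₁ c)) (w : (𝒢.LG L).HT (ρ.hgz.pr₂ c)) :
    L.castFib (𝒢.src_pr₁ ((𝒢.LP L).hproj c)) (-(ρ.act (𝒢.pr₁ ((𝒢.LP L).hproj c))).symm
        ((𝒢.LG L).pTstar (ρ.hgz.pr₁ c) η ((𝒢.LG L).pT (ρ.hgz.pr₁ c) u))) =
      (𝒢.LG L).pTstar (ρ.hgz.pr₂ c) θ ((𝒢.LG L).pT (ρ.hgz.pr₂ c) w) ↔ -η u = θ w :=
  ((𝒢.LG L).bijective_form (ρ.hgz.pr₂ c)).1.eq_iff.symm.trans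
    (Eq.congr ((ρ.form_castFib_neg_act_symm c _).trans
        (congrArg Neg.neg ((𝒢.LG L).form_pTstar_pT (ρ.hgz.pr₁ c) η u)))
      ((𝒢.LG L).form_pTstar_pT (ρ.hgz.pr₂ c) θ w))

variable [IsManifold IP ∞ P]

theorem hgz_toFun_mul_iff {l m : ℕ} (T : (𝒢.LG L).AtiyahTensor l m) (c : (𝒢.LP L).Hgz)
    (ξ : Fin l → (𝒢.LP L).HT c) (η : Fin m → ((𝒢.LG L).HT (ρ.hgz.pr₁ c) →L[ℝ] ℝ))
    (θ : Fin m → ((𝒢.LG L).HT (ρ.hgz.pr₂ c) →L[ℝ] ℝ))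
    (κ : Fin m → ((𝒢.LG L).HT (ρ.hgz.mul c) →L[ℝ] ℝ)) :
    (T.toFun (𝒢.mul ((𝒢.LP L).hproj c)) (fun i => (𝒢.mL L).D _ ((𝒢.LP L).pT c (ξ i)))
        (fun j => (𝒢.LG L).pTstar (ρ.hgz.mul c) (κ j)) =
      ρ.mulLG ((𝒢.LP L).hproj c)
        (T.toFun _ (fun i => (𝒢.p₁L L).D _ ((𝒢.LP L).pT c (ξ i)))
          fun j => (𝒢.LG L).pTstar (ρ.hgz.pr₁ c) (η j))
        (T.toFun _ (fun i => ρ.p₂L.D _ ((𝒢.LP L).pT c (ξ i)))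
          fun j => (𝒢.LG L).pTstar (ρ.hgz.pr₂ c) (θ j))) ↔
      T.hgz (ρ.hgz.mul c) (fun i => (𝒢.mL L).dhgz c (ξ i)) κ =
        T.hgz (ρ.hgz.pr₁ c) (fun i => (𝒢.p₁L L).dhgz c (ξ i)) η +
        T.hgz (ρ.hgz.pr₂ c) (fun i => ρ.p₂L.dhgz c (ξ i)) θ :=
  (ρ.eq_mulLG_iff c).trans (Eq.congr ((𝒢.mL L).hgz_apply_dhgz T c ξ κ).symm
    (congrArg₂ (· + ·) ((𝒢.p₁L L).hgz_apply_dhgz T c ξ η).symm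
      (ρ.p₂L.hgz_apply_dhgz T c ξ θ).symm))

variable [FiniteDimensional ℝ EP]

theorem jetMul_pTstar_iff (c : (𝒢.LP L).Hgz)
    (η : (𝒢.LG L).HT (ρ.hgz.pr₁ c) →L[ℝ] ℝ) (θ : (𝒢.LG L).HT (ρ.hgz.pr₂ c) →L[ℝ] ℝ)
    (κ : (𝒢.LG L).HT (ρ.hgz.mul c) →L[ℝ] ℝ) :
    ρ.JetMul ((𝒢.LP L).hproj c) ((𝒢.LG L).pTstar (ρ.hgz.pr₁ c) η)
        ((𝒢.LG L).pTstar (ρ.hgz.pr₂ c) θ) ((𝒢.LG L).pTstar (ρ.hgz.mul c) κ) ↔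
      ρ.hgz.CotangentMul 𝓘ₕ(IG) 𝓘ₕ(IP) c η θ κ := by
  have : T2Space P := 𝒢.t2Space_pairs
  refine ((𝒢.LP L).pT_bijective c).2.forall.trans (forall_congr' fun ξ => ?_)
  exact (ρ.eq_mulLG_iff c).trans (Eq.congr ((𝒢.mL L).form_pTstar_D_pT c ξ κ)
    (congrArg₂ (· + ·) ((𝒢.p₁L L).form_pTstar_D_pT c ξ η) (ρ.p₂L.form_pTstar_D_pT c ξ θ)))

theorem tangentMul_iff {V W U : TangentBundle 𝓘ₕ(IG) (𝒢.LG L).Hgz} :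
    ρ.hgz.TangentMul 𝓘ₕ(IG) 𝓘ₕ(IP) V W U ↔
      ρ.hgz.src V.proj = ρ.hgz.tgt W.proj ∧ ρ.hgz.tgt U.proj = ρ.hgz.tgt V.proj ∧
        ρ.DMul ((𝒢.LG L).pTTot V) ((𝒢.LG L).pTTot W) ((𝒢.LG L).pTTot U) := by
  have : T2Space P := 𝒢.t2Space_pairs
  constructor
  · rintro ⟨ξ, rfl, rfl, rfl⟩
    exact ⟨ρ.hgz_src_pr₁ ξ.proj, ρ.hgz_tgt_mul ξ.proj, (𝒢.LP L).pTTot ξ,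
      (𝒢.p₁L L).dTot_pTTot ξ, ρ.p₂L.dTot_pTTot ξ, (𝒢.mL L).dTot_pTTot ξ⟩
  · rintro ⟨hVW, hUV, ⟨k, B⟩, h₁, h₂, h₃⟩
    obtain ⟨c, rfl, hc₁ : ρ.hgz.pr₁ c = V.proj⟩ :=
      (𝒢.p₁L L).exists_hproj_eq_hgz_eq (congrArg Sigma.fst h₁)
    obtain ⟨ξ, rfl⟩ := ((𝒢.LP L).pT_bijective c).2 B
    have hc₂ : ρ.hgz.pr₂ c = W.proj := (𝒢.tL L).hgz_injOn_fiber (congrArg Sigma.fst h₂)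
      ((ρ.hgz_src_pr₁ c).symm.trans ((congrArg ρ.hgz.src hc₁).trans hVW))
    have hc₃ : ρ.hgz.mul c = U.proj := (𝒢.tL L).hgz_injOn_fiber (congrArg Sigma.fst h₃)
      ((ρ.hgz_tgt_mul c).trans ((congrArg ρ.hgz.tgt hc₁).trans hUV.symm))
    exact ⟨⟨c, ξ⟩,
      (𝒢.LG L).pTTot_injOn_fiber hc₁ (((𝒢.p₁L L).dTot_pTTot ⟨c, ξ⟩).symm.trans h₁),
      (𝒢.LG L).pTTot_injOn_fiber hc₂ ((ρ.p₂L.dTot_pTTot ⟨c, ξ⟩).symm.trans h₂),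
      (𝒢.LG L).pTTot_injOn_fiber hc₃ (((𝒢.mL L).dTot_pTTot ⟨c, ξ⟩).symm.trans h₃)⟩

theorem dMul_zero_iL_iff (c : (𝒢.LP L).Hgz)
    (a : (𝒢.LG L).HT (ρ.hgz.one (ρ.hgz.src (ρ.hgz.pr₁ c)))) (u : (𝒢.LG L).HT (ρ.hgz.pr₁ c)) :
    ρ.DMul ⟨𝒢.pr₁ ((𝒢.LP L).hproj c), 0⟩ (ρ.iL.DTot ((𝒢.LG L).pTTot ⟨_, a⟩))
        ((𝒢.LG L).pTTot ⟨_, u⟩) ↔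
      ρ.hgz.TangentMul 𝓘ₕ(IG) 𝓘ₕ(IP) ⟨ρ.hgz.pr₁ c, 0⟩
        (tangentMap 𝓘ₕ(IG) 𝓘ₕ(IG) ρ.hgz.inv ⟨_, a⟩) ⟨_, u⟩ := by
  have hsrc : ρ.hgz.src (ρ.hgz.pr₁ c) =
      ρ.hgz.tgt (ρ.hgz.inv (ρ.hgz.one (ρ.hgz.src (ρ.hgz.pr₁ c)))) :=
    ((ρ.hgz_tgt_inv _).trans (ρ.hgz_src_one _)).symm
  rw [tangentMul_iff, LineBundle.pTTot_zero, LineBundleMap.dTot_pTTot]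
  exact ⟨fun h => ⟨hsrc, rfl, h⟩, fun h => h.2.2⟩

theorem dMul_pTTot_zero_iff (c : (𝒢.LP L).Hgz)
    (a : (𝒢.LG L).HT (ρ.hgz.one (ρ.hgz.src (ρ.hgz.pr₁ c)))) (w : (𝒢.LG L).HT (ρ.hgz.pr₂ c)) :
    ρ.DMul ((𝒢.LG L).pTTot ⟨_, a⟩) ⟨𝒢.pr₂ ((𝒢.LP L).hproj c), 0⟩ ((𝒢.LG L).pTTot ⟨_, w⟩) ↔
      ρ.hgz.TangentMul 𝓘ₕ(IG) 𝓘ₕ(IP) ⟨_, a⟩ ⟨ρ.hgz.pr₂ c, 0⟩ ⟨_, w⟩ := by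
  have hsrc := (ρ.hgz_src_one (ρ.hgz.src (ρ.hgz.pr₁ c))).trans (ρ.hgz_src_pr₁ c)
  have htgt := (ρ.hgz_src_pr₁ c).symm.trans (ρ.hgz_tgt_one (ρ.hgz.src (ρ.hgz.pr₁ c))).symm
  rw [tangentMul_iff, LineBundle.pTTot_zero]
  exact ⟨fun h => ⟨hsrc, htgt, h⟩, fun h => h.2.2⟩

theorem jetComposable_pTstar_iff [FiniteDimensional ℝ EM] [IsManifold IM ∞ M] [T2Space M]
    (c : (𝒢.LP L).Hgz) (η : (𝒢.LG L).HT (ρ.hgz.pr₁ c) →L[ℝ] ℝ)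
    (θ : (𝒢.LG L).HT (ρ.hgz.pr₂ c) →L[ℝ] ℝ) :
    ρ.JetComposable ((𝒢.LP L).hproj c) ((𝒢.LG L).pTstar (ρ.hgz.pr₁ c) η)
        ((𝒢.LG L).pTstar (ρ.hgz.pr₂ c) θ) ↔
      ρ.hgz.CotangentComposable 𝓘ₕ(IM) 𝓘ₕ(IG) 𝓘ₕ(IP) c η θ := by
  let x := ρ.hgz.src (ρ.hgz.pr₁ c)
  refine ((𝒢.LG L).pT_bijective (ρ.hgz.one x)).2.forall.trans (forall_congr' fun a => ?_)
  refine imp_congr (ρ.pT_mem_core_iff x a) ?_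
  refine ((𝒢.LG L).pT_bijective (ρ.hgz.pr₁ c)).2.forall.trans (forall_congr' fun u => ?_)
  refine ((𝒢.LG L).pT_bijective (ρ.hgz.pr₂ c)).2.forall.trans (forall_congr' fun w => ?_)
  exact imp_congr (ρ.dMul_zero_iL_iff c a u)
    (imp_congr (ρ.dMul_pTTot_zero_iff c a w) (ρ.castFib_neg_act_symm_pTstar_eq_iff c η θ u w))

end LineAction

end LieGroupoid

theorem mainTheorem9_general
    {EM : Type*} [NormedAddCommGroup EM] [NormedSpace ℝ EM] [FiniteDimensional ℝ EM]
    {HM : Type*} [TopologicalSpace HM] {IM : ModelWithCorners ℝ EM HM}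
    {M : Type*} [TopologicalSpace M] [ChartedSpace HM M] [IsManifold IM ∞ M] [T2Space M]
    {EG : Type*} [NormedAddCommGroup EG] [NormedSpace ℝ EG] [FiniteDimensional ℝ EG]
    {HG : Type*} [TopologicalSpace HG] {IG : ModelWithCorners ℝ EG HG}
    {G : Type*} [TopologicalSpace G] [ChartedSpace HG G] [IsManifold IG ∞ G] [T2Space G]
    {EP : Type*} [NormedAddCommGroup EP] [NormedSpace ℝ EP] [FiniteDimensional ℝ EP]
    {HP : Type*} [TopologicalSpace HP] {IP : ModelWithCorners ℝ EP HP}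
    {P : Type*} [TopologicalSpace P] [ChartedSpace HP P] [IsManifold IP ∞ P]
    (𝒢 : LieGroupoid IM M IG G IP P) (L : LineBundle IM M) (ρ : 𝒢.LineAction L)
    (l m : ℕ) (T : (𝒢.LG L).AtiyahTensor l m) :
    ρ.IsMultiplicative T ↔
      ρ.hgz.IsMultiplicativeTensor 𝓘ₕ(IM) 𝓘ₕ(IG) 𝓘ₕ(IP) T.hgz := by
  have : T2Space P := 𝒢.t2Space_pairs
  have pTstar_surj (g : (𝒢.LG L).Hgz) :
      Function.Surjective ((𝒢.LG L).pTstar g ∘ · : (Fin m → _) → _) :=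
    ((𝒢.LG L).pTstar_surjective g).comp_left
  refine (𝒢.LP L).hproj_surjective.forall.trans (forall_congr' fun c => ?_)
  refine ((𝒢.LP L).pT_bijective c).2.comp_left.forall.trans (forall_congr' fun ξ => ?_)
  refine (pTstar_surj (ρ.hgz.pr₁ c)).forall.trans (forall_congr' fun η => ?_)
  refine (pTstar_surj (ρ.hgz.pr₂ c)).forall.trans (forall_congr' fun θ => ?_)
  refine (pTstar_surj (ρ.hgz.mul c)).forall.trans (forall_congr' fun κ => ?_)
  exact imp_congr (forall_congr' fun j => ρ.jetComposable_pTstar_iff c (η j) (θ j))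
    (imp_congr (forall_congr' fun j => ρ.jetMul_pTstar_iff c (η j) (θ j) (κ j))
      (ρ.hgz_toFun_mul_iff T c ξ η θ κ))

theorem mainTheorem9
    {EM : Type*} [NormedAddCommGroup EM] [NormedSpace ℝ EM] [FiniteDimensional ℝ EM]
    {M : Type*} [TopologicalSpace M] [ChartedSpace EM M] [IsManifold 𝓘(ℝ, EM) ∞ M] [T2Space M]
    {EG : Type*} [NormedAddCommGroup EG] [NormedSpace ℝ EG] [FiniteDimensional ℝ EG]
    {G : Type*} [TopologicalSpace G] [ChartedSpace EG G] [IsManifold 𝓘(ℝ, EG) ∞ G] [T2Space G]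
    {EP : Type*} [NormedAddCommGroup EP] [NormedSpace ℝ EP] [FiniteDimensional ℝ EP]
    {P : Type*} [TopologicalSpace P] [ChartedSpace EP P] [IsManifold 𝓘(ℝ, EP) ∞ P]
    (𝒢 : LieGroupoid 𝓘(ℝ, EM) M 𝓘(ℝ, EG) G 𝓘(ℝ, EP) P)
    (L : LineBundle 𝓘(ℝ, EM) M) (ρ : 𝒢.LineAction L)
    (l m : ℕ) (T : (𝒢.LG L).AtiyahTensor l m) :
    ρ.IsMultiplicative T ↔
      ρ.hgz.IsMultiplicativeTensor (𝓘(ℝ, EM).prod 𝓘(ℝ, ℝ →L[ℝ] ℝ))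
        (𝓘(ℝ, EG).prod 𝓘(ℝ, ℝ →L[ℝ] ℝ)) (𝓘(ℝ, EP).prod 𝓘(ℝ, ℝ →L[ℝ] ℝ)) T.hgz :=
  mainTheorem9_general 𝒢 L ρ l m T
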